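/- **Setting (the i.i.d. change-point model $\mathcal M_s$).** There are $K$ parallel data streams. The change points $\tau_1,\dots,\tau_K$ are i.i.d. with $\mathbb P(\tau_k=m)=\theta(1-\theta)^m$, $m=0,1,2,\dots$, for some $\theta\in(0,1)$. Given the change points, the observations $X_{k,t}$ ($1\le k\le K$, $t=1,2,\dots$) are independent, and $X_{k,t}$ has density $p$ if $t\le\tau_k$ and density $q$ if $t>\tau_k$, with respect to some baseline measure $\mu$; $p$ and $q$ do not depend on $k,t$. A *compound sequential detection procedure* is a process of index sets $S_1\supseteq S_2\supseteq\cdots$ (active streams) with $S_1=\{1,\dots,K\}$, such that $S_{t+1}$ is $\mathcal F_t$-measurable for every $t\ge1$, where $\mathcal F_1=\sigma(X_{k,1}: 1\le k\le K)$ and $\mathcal F_{t+1}=\sigma(\mathcal F_t,S_{t+1},X_{k,t+1}: k\in S_{t+1})$. It is also written as $\mathbb T=(T_1,\dots,T_K)$ with $T_k=\sup\{t: k\in S_t\}$. Let $\mathrm{LFNR}_1=0$ and $$\mathrm{LFNR}_{t+1}(\mathbb T)=\mathbb E\Big(\frac{\sum_{k\in S_{t+1}}\mathbf 1(\tau_k<t)}{|S_{t+1}|\vee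 1}\,\Big|\,\mathcal F_t\Big),\quad t\ge1 .$$ For $\alpha\in(0,1]$ let $\mathcal T_\alpha$ be the class of procedures with $\mathrm{LFNR}_t(\mathbb T)\le\alpha$ a.s. for all $t\ge1$. The *proposed procedure* $\mathbb T^*$ starts with $S_1=\{1,\dots,K\}$. At each time $t\ge1$, let $W_{k,t}=\mathbb P(\tau_k<t\mid\mathcal F_t)$, sort $S_t=\{k_1,\dots,k_{|S_t|}\}$ so that $W_{k_1,t}\le W_{k_2,t}\le\cdots$ (ties are broken by the smaller index first), let $R_0=0$ and $R_n=\frac1n\sum_{i=1}^nW_{k_i,t}$, and set $S_{t+1}=\{k_1,\dots,k_n\}$ for the largest $n\in\{0,1,\dots,|S_t|\}$ with $R_n\le\alpha$. Define the pre-change run length and the cumulative number of detections by $$\mathrm{RL}_t(\mathbb T)=\sum_{k=1}^K(T_k\wedge\tau_k\wedge t),\qquad \mathrm{CD}_t(\mathbb T)=K-|S_t| .$$ **Theorem.** Under model $\mathcal M_s$, for every $\alpha\in(0,1]$ we have $\mathbb T^*\in\mathcal T_\alpha$, and for all $t=1,2,\dots$, $$\mathbb E(\mathrm{RL}_t(\mathbb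 T^*))=\sup_{\mathbb T\in\mathcal T_\alpha}\mathbb E(\mathrm{RL}_t(\mathbb T))\quad\text{and}\quad \mathbb E(\mathrm{CD}_t(\mathbb T^*))=\inf_{\mathbb T\in\mathcal T_\alpha}\mathbb E(\mathrm{CD}_t(\mathbb T)).$$ -/

import Mathlib

open MeasureTheory ProbabilityTheory
open scoped ENNReal

namespace CompoundDetection

/-! Time is indexed by natural numbers; observations and active sets are meaningful for
`t = 1, 2, …` only (the values `X k 0` and `S 0` are never used). The streams are indexed by
`Fin K`, change points take values in `{0, 1, 2, …} ∪ {∞}`. -/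

/-- Bayesian change-point model for `K` parallel streams: conditionally on the change points
(which take countably many values), the observations `X k t`, `t ≥ 1`, are independent over `k`
and `t`, and `X k t` has density `p k t` (w.r.t. the baseline measure `μ`) if `t ≤ τ k` and
density `q k t` if `t > τ k`. -/
structure IsChangePointModel {Ω E : Type*} [MeasurableSpace Ω] [MeasurableSpace E] {K : ℕ}
    (P : Measure Ω) (μ : Measure E) (p q : Fin K → ℕ → E → ℝ≥0∞)
    (τ : Fin K → Ω → ℕ∞) (X : Fin K → ℕ → Ω → E) : Prop where
  measurable_p : ∀ k t, 1 ≤ t → Measurable (p k t)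
  measurable_q : ∀ k t, 1 ≤ t → Measurable (q k t)
  lintegral_p : ∀ k t, 1 ≤ t → ∫⁻ x, p k t x ∂μ = 1
  lintegral_q : ∀ k t, 1 ≤ t → ∫⁻ x, q k t x ∂μ = 1
  measurable_tau : ∀ k, Measurable (τ k)
  measurable_X : ∀ k t, 1 ≤ t → Measurable (X k t)
  condIndep : ∀ m : Fin K → ℕ∞, P {ω | ∀ k, τ k ω = m k} ≠ 0 →
    iIndepFun (fun (i : Fin K × ℕ) => X i.1 (i.2 + 1)) (cond P {ω | ∀ k, τ k ω = m k})
  condLaw : ∀ m : Fin K → ℕ∞, P {ω | ∀ k, τ k ω = m k} ≠ 0 → ∀ k (t : ℕ), 1 ≤ t →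
    (cond P {ω | ∀ k, τ k ω = m k}).map (X k t)
      = μ.withDensity (if (t : ℕ∞) ≤ m k then p k t else q k t)

/-- The i.i.d. change-point model: the change points are independent, geometric on
`{0, 1, 2, …}` with parameter `θ`, and the pre- and post-change densities `p`, `q` are the same
for all streams and times. -/
structure IsIIDModel {Ω E : Type*} [MeasurableSpace Ω] [MeasurableSpace E] {K : ℕ}
    (P : Measure Ω) (μ : Measure E) (p q : E → ℝ≥0∞) (θ : ℝ)
    (τ : Fin K → Ω → ℕ∞) (X : Fin K → ℕ → Ω → E) : Prop where
  model : IsChangePointModel P μ (fun _ _ => p) (fun _ _ => q) τ X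
  indep_tau : iIndepFun τ P
  geometric_tau : ∀ k (m : ℕ), P {ω | τ k ω = (m : ℕ∞)} = ENNReal.ofReal (θ * (1 - θ) ^ m)

/-- `σ(F, S, X_k for k ∈ S)` for a random index set `S`: the observation of stream `k` is
available only on the event `{k ∈ S}`. -/
@[reducible] def stepSigma {Ω E : Type*} [MeasurableSpace E] {K : ℕ} (F : MeasurableSpace Ω)
    (S : Ω → Finset (Fin K)) (X : Fin K → Ω → E) : MeasurableSpace Ω :=
  F ⊔ MeasurableSpace.comap S ⊤ ⊔
    MeasurableSpace.generateFrom
      {B | ∃ (k : Fin K) (A : Set E), MeasurableSet A ∧ B = {ω | k ∈ S ω ∧ X k ω ∈ A}}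

/-- The information filtration `F_t = σ(F_{t-1}, S_t, X_{k,t} for k ∈ S_t)` of an index set
process, started from the trivial `F_0` (when `S_1` is everything, `F_1 = σ(X_{k,1}, all k)`). -/
@[reducible] def info {Ω E : Type*} [MeasurableSpace E] {K : ℕ} (X : Fin K → ℕ → Ω → E)
    (S : ℕ → Ω → Finset (Fin K)) : ℕ → MeasurableSpace Ω
  | 0 => ⊥
  | t + 1 => stepSigma (info X S t) (S (t + 1)) (fun k => X k (t + 1))

/-- Compound sequential detection procedures, given by the sets `S t` of active streams:
all streams are active at time `1`, deactivation is permanent, and `S (t + 1)` is determined by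
the information collected up to time `t`. -/
structure IsProcedure {Ω E : Type*} [MeasurableSpace E] {K : ℕ} (X : Fin K → ℕ → Ω → E)
    (S : ℕ → Ω → Finset (Fin K)) : Prop where
  start : ∀ ω, S 1 ω = Finset.univ
  anti : ∀ t, 1 ≤ t → ∀ ω, S (t + 1) ω ⊆ S t ω
  adapted : ∀ t, 1 ≤ t → ∀ A : Finset (Fin K), MeasurableSet[info X S t] {ω | S (t + 1) ω = A}

/-- The false non-discovery proportion
`FNP_{t+1} = (∑_{k ∈ S_{t+1}} 1(τ_k < t)) / (|S_{t+1}| ∨ 1)`; in particular `FNP_1 = 0`. -/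
noncomputable def FNP {Ω : Type*} {K : ℕ} (τ : Fin K → Ω → ℕ∞)
    (S : ℕ → Ω → Finset (Fin K)) : ℕ → Ω → ℝ
  | 0 => fun _ => 0
  | t + 1 => fun ω =>
      (∑ k ∈ S (t + 1) ω, if τ k ω < (t : ℕ∞) then (1 : ℝ) else 0)
        / (max (S (t + 1) ω).card 1 : ℕ)

/-- The local false non-discovery rate `LFNR_{t+1} = E(FNP_{t+1} | F_t)`; `LFNR_1 = 0`. -/
noncomputable def LFNR {Ω E : Type*} [MeasurableSpace Ω] [MeasurableSpace E] {K : ℕ}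
    (P : Measure Ω) (τ : Fin K → Ω → ℕ∞) (X : Fin K → ℕ → Ω → E)
    (S : ℕ → Ω → Finset (Fin K)) : ℕ → Ω → ℝ
  | 0 => fun _ => 0
  | t + 1 => P[FNP τ S (t + 1) | info X S t]

/-- The class of procedures whose LFNR is at most `α` at all times. -/
def controlled {Ω E : Type*} [MeasurableSpace Ω] [MeasurableSpace E] {K : ℕ}
    (P : Measure Ω) (τ : Fin K → Ω → ℕ∞) (X : Fin K → ℕ → Ω → E) (α : ℝ) :
    Set (ℕ → Ω → Finset (Fin K)) :=
  {S | IsProcedure X S ∧ ∀ t, 1 ≤ t → ∀ᵐ ω ∂P, LFNR P τ X S t ω ≤ α}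

/-- The first `n` elements `k_1, …, k_n` of `S` when its elements are sorted in ascending order
of `w`, ties being broken by the index: those `k ∈ S` with fewer than `n` predecessors in `S`. -/
noncomputable def firstElts {K : ℕ} (S : Finset (Fin K)) (w : Fin K → ℝ) (n : ℕ) :
    Finset (Fin K) :=
  {k ∈ S | (Finset.card {j ∈ S | w j < w k ∨ (w j = w k ∧ j < k)}) < n}

open Classical in
/-- One-step update rule: keep `k_1, …, k_n` for the largest `n ∈ {0, …, |S|}` with
`R_n = (w_{k_1} + ⋯ + w_{k_n}) / n ≤ α`, where `R_0 = 0`. -/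
noncomputable def oneStep {K : ℕ} (α : ℝ) (S : Finset (Fin K)) (w : Fin K → ℝ) :
    Finset (Fin K) :=
  firstElts S w
    (Nat.findGreatest (fun n => (∑ k ∈ firstElts S w n, w k) / (n : ℝ) ≤ α) S.card)

/-- The posterior probability `P(τ_k < t | F)`. -/
noncomputable def postProb {Ω : Type*} (F : MeasurableSpace Ω) [MeasurableSpace Ω] {K : ℕ}
    (P : Measure Ω) (τ : Fin K → Ω → ℕ∞) (t : ℕ) (k : Fin K) : Ω → ℝ :=
  P[{ω | τ k ω < (t : ℕ∞)}.indicator (fun _ => (1 : ℝ)) | F]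

/-- The pair `(F_t, S_{t+1})` of the proposed procedure, built recursively: `S_1` is everything,
`F_{t+1} = σ(F_t, S_{t+1}, X_{k,t+1} for k ∈ S_{t+1})`, and `S_{t+2}` is obtained from `S_{t+1}`
by the one-step update rule with `W_{k,t+1} = P(τ_k < t+1 | F_{t+1})`. -/
noncomputable def proposedAux {Ω E : Type*} [MeasurableSpace Ω] [MeasurableSpace E] {K : ℕ}
    (P : Measure Ω) (τ : Fin K → Ω → ℕ∞) (X : Fin K → ℕ → Ω → E) (α : ℝ) :
    ℕ → MeasurableSpace Ω × (Ω → Finset (Fin K))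
  | 0 => (⊥, fun _ => Finset.univ)
  | t + 1 =>
      (stepSigma (proposedAux P τ X α t).1 (proposedAux P τ X α t).2 (fun k => X k (t + 1)),
        fun ω => oneStep α ((proposedAux P τ X α t).2 ω) (fun k =>
          postProb (stepSigma (proposedAux P τ X α t).1 (proposedAux P τ X α t).2
            (fun j => X j (t + 1))) P τ (t + 1) k ω))

/-- The active sets of the proposed procedure. -/
noncomputable def proposed {Ω E : Type*} [MeasurableSpace Ω] [MeasurableSpace E] {K : ℕ}
    (P : Measure Ω) (τ : Fin K → Ω → ℕ∞) (X : Fin K → ℕ → Ω → E) (α : ℝ) :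
    ℕ → Ω → Finset (Fin K)
  | 0 => fun _ => Finset.univ
  | t + 1 => (proposedAux P τ X α t).2

/-- The detection time `T_k = sup {t : k ∈ S_t}`, possibly infinite. -/
noncomputable def detectionTime {Ω : Type*} {K : ℕ} (S : ℕ → Ω → Finset (Fin K)) (k : Fin K)
    (ω : Ω) : ℕ∞ :=
  sSup {n : ℕ∞ | ∃ t : ℕ, 1 ≤ t ∧ k ∈ S t ω ∧ n = (t : ℕ∞)}

/-- The pre-change run length `RL_t = ∑_k (T_k ∧ τ_k ∧ t)`. -/
noncomputable def RL {Ω : Type*} {K : ℕ} (τ : Fin K → Ω → ℕ∞) (S : ℕ → Ω → Finset (Fin K))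
    (t : ℕ) (ω : Ω) : ℝ :=
  ∑ k, ((min (min (detectionTime S k ω) (τ k ω)) (t : ℕ∞)).toNat : ℝ)

/-- The cumulative number of detections `CD_t = K - |S_t|`. -/
noncomputable def CD {Ω : Type*} {K : ℕ} (S : ℕ → Ω → Finset (Fin K)) (t : ℕ) (ω : Ω) : ℝ :=
  (K : ℝ) - ((S t ω).card : ℝ)

end CompoundDetection

/-! A stream matters only through its posterior probability `W` of a past change. The recursion
`filt` computes it: the hazard step `w ↦ w + (1 - w) θ`, valid because the geometric law is
memoryless, followed by Bayes' rule. Given the past, the next observations are independent over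
streams with predictive densities that depend on the current `W` alone, so the vector of posteriors
is a Markov chain with operator `transition`. A deactivated stream is put in the absorbing state
`2`. A procedure sees only its active streams, but for these the posterior given all observations is
available to it, and the constraint becomes: the sum of `W_{k,t}` over `S_{t+1}` is at most `α
|S_{t+1}|` (`IsObserved.LFNR_succ`, `IsObserved.sum_weight_le`).

Call a state `x` more favourable than `y` if `x ∘ π ≤ y` for some permutation `π`. Two monotonicity
facts carry the proof. Selection: from a more favourable state, the one-step rule reaches a state at
least as favourable as any admissible selection from a less favourable one
(`exists_perm_stepState_le`, an exchange argument). Dynamics: `transition` preserves the symmetric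
functions that decrease in each coordinate (`SymmAntitone.transition`), because the posterior of one
stream is stochastically increasing in its starting value (`lintegral_nextState_antitone`).

Induction on time then shows that the greedy rule maximizes, at every time, the expectation of all
bounded measurable functions of this class simultaneously (`IsObserved.lintegral_mask_le_proposed`),
so myopic choices cost nothing later. Both criteria are of this kind: the number of active streams
is the sum of `1(x_k ≤ 1)`, and the expected increment of the run length is the expectation of the
sum of the positive parts of `(1 - θ)(1 - max 0 x_k)`. -/

namespace CompoundDetection

/-! ### The one-step selection rule: exchange argument and measurability. -/

section Selection

variable {K : ℕ}

/-- The number of elements of `S` that precede `k` in the order of weights, ties being broken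
by the index. -/
noncomputable def weightRank (S : Finset (Fin K)) (w : Fin K → ℝ) (k : Fin K) : ℕ :=
  Finset.card {j ∈ S | w j < w k ∨ (w j = w k ∧ j < k)}

lemma firstElts_eq (S : Finset (Fin K)) (w : Fin K → ℝ) (n : ℕ) :
    firstElts S w n = {k ∈ S | weightRank S w k < n} := rfl

lemma firstElts_subset (S : Finset (Fin K)) (w : Fin K → ℝ) (n : ℕ) : firstElts S w n ⊆ S :=
  Finset.filter_subset _ _

lemma firstElts_mono (S : Finset (Fin K)) (w : Fin K → ℝ) {m n : ℕ} (h : m ≤ n) :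
    firstElts S w m ⊆ firstElts S w n := by
  intro k
  simp only [firstElts_eq, Finset.mem_filter]
  exact fun hk => ⟨hk.1, hk.2.trans_le h⟩

lemma weightRank_lt_card {S : Finset (Fin K)} {w : Fin K → ℝ} {k : Fin K} (hk : k ∈ S) :
    weightRank S w k < S.card := by
  apply Finset.card_lt_card
  refine ⟨Finset.filter_subset _ _, fun h => ?_⟩
  have := h hk
  simp at this

/-- Transitivity of the lexicographic order gives inclusion of the predecessor sets, and `j` itself
makes it strict. Hence ranks are distinct and fill `0, …, |S| - 1`. -/
lemma weightRank_lt_of_precedes {S : Finset (Fin K)} {w : Fin K → ℝ} {j k : Fin K} (hj : j ∈ S)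
    (h : w j < w k ∨ (w j = w k ∧ j < k)) : weightRank S w j < weightRank S w k := by
  apply Finset.card_lt_card
  refine ⟨fun i hi => ?_, fun h' => ?_⟩
  · simp only [Finset.mem_filter] at hi ⊢
    refine ⟨hi.1, ?_⟩
    rcases hi.2 with h1 | h1 <;> rcases h with h2 | h2
    · exact Or.inl (h1.trans h2)
    · exact Or.inl (h2.1 ▸ h1)
    · exact Or.inl (h1.1 ▸ h2)
    · exact Or.inr ⟨h1.1.trans h2.1, h1.2.trans h2.2⟩
  · have : j ∈ ({i ∈ S | w i < w j ∨ (w i = w j ∧ i < j)} : Finset (Fin K)) :=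
      h' (by simp [hj, h])
    simp at this

lemma weightRank_injOn (S : Finset (Fin K)) (w : Fin K → ℝ) :
    Set.InjOn (weightRank S w) S := by
  intro j hj k hk h
  by_contra hne
  rcases lt_trichotomy (w j) (w k) with h1 | h1 | h1
  · exact (weightRank_lt_of_precedes hj (Or.inl h1)).ne h
  · rcases lt_or_gt_of_ne hne with h2 | h2
    · exact (weightRank_lt_of_precedes hj (Or.inr ⟨h1, h2⟩)).ne h
    · exact (weightRank_lt_of_precedes hk (Or.inr ⟨h1.symm, h2⟩)).ne h.symm
  · exact (weightRank_lt_of_precedes hk (Or.inl h1)).ne h.symm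

lemma image_weightRank (S : Finset (Fin K)) (w : Fin K → ℝ) :
    S.image (weightRank S w) = Finset.range S.card := by
  apply Finset.eq_of_subset_of_card_le
  · intro i hi
    obtain ⟨k, hk, rfl⟩ := Finset.mem_image.1 hi
    exact Finset.mem_range.2 (weightRank_lt_card hk)
  · rw [Finset.card_range, Finset.card_image_of_injOn (weightRank_injOn S w)]

lemma card_firstElts {S : Finset (Fin K)} {w : Fin K → ℝ} {n : ℕ} (hn : n ≤ S.card) :
    (firstElts S w n).card = n := by
  have h : (firstElts S w n).image (weightRank S w) = Finset.range n := by
    rw [firstElts_eq, ← Finset.filter_image (p := fun i => i < n), image_weightRank]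
    ext i
    simp only [Finset.mem_filter, Finset.mem_range]
    omega
  have h' := Finset.card_image_of_injOn
    ((weightRank_injOn S w).mono (Finset.coe_subset.2 (firstElts_subset S w n)))
  rw [← h', h, Finset.card_range]

lemma weight_le_of_mem_firstElts {S : Finset (Fin K)} {w : Fin K → ℝ} {n : ℕ} {j k : Fin K}
    (hk : k ∈ firstElts S w n) (hj : j ∈ S) (hj' : j ∉ firstElts S w n) : w k ≤ w j := by
  rw [firstElts_eq, Finset.mem_filter] at hk hj'
  by_contra! h
  exact hj' ⟨hj, (weightRank_lt_of_precedes hj (Or.inl h)).trans hk.2⟩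

/-- Exchange: if the elements of `F` have smaller weights than those of `A \ F` and `F`, `A` have
the same cardinality, then some permutation maps `A` into `F` and decreases weights on `A`. -/
lemma exists_perm_exchange {w : Fin K → ℝ} {A F : Finset (Fin K)} (hcard : A.card = F.card)
    (h : ∀ k ∈ F, ∀ j ∈ A, j ∉ F → w k ≤ w j) :
    ∃ σ : Equiv.Perm (Fin K), ∀ i ∈ A, σ i ∈ F ∧ w (σ i) ≤ w i := by
  have hc : (A \ F).card = (F \ A).card := by
    have h1 := Finset.card_sdiff_add_card_inter A F
    have h2 := Finset.card_sdiff_add_card_inter F A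
    rw [Finset.inter_comm] at h2
    omega
  -- Swapping `A \ F` with `F \ A` along `e` and fixing everything else is an involution, hence a
  -- permutation.
  let e := Finset.equivOfCardEq hc
  have he1 (i) (hi : i ∈ A \ F) : (e ⟨i, hi⟩ : Fin K) ∈ F \ A := (e ⟨i, hi⟩).2
  have he2 (i) (hi : i ∈ F \ A) : (e.symm ⟨i, hi⟩ : Fin K) ∈ A \ F := (e.symm ⟨i, hi⟩).2
  have hdis (i) (hi : i ∈ F \ A) : i ∉ A \ F := by
    simp only [Finset.mem_sdiff] at hi ⊢; tauto
  let f : Fin K → Fin K := fun i =>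
    if hi : i ∈ A \ F then e ⟨i, hi⟩ else if hi : i ∈ F \ A then e.symm ⟨i, hi⟩ else i
  have hf : Function.Involutive f := by
    intro i
    by_cases h1 : i ∈ A \ F
    · have : f i = e ⟨i, h1⟩ := dif_pos h1
      rw [this]
      have h2 := he1 i h1
      simp only [f, dif_neg (hdis _ h2), dif_pos h2, Subtype.coe_eta, Equiv.symm_apply_apply]
    · by_cases h2 : i ∈ F \ A
      · have : f i = e.symm ⟨i, h2⟩ := by simp only [f, dif_neg h1, dif_pos h2]
        rw [this]
        have h3 := he2 i h2
        simp only [f, dif_pos h3, Subtype.coe_eta, Equiv.apply_symm_apply]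
      · have : f i = i := by simp only [f, dif_neg h1, dif_neg h2]
        rw [this, this]
  refine ⟨hf.toPerm f, fun i hi => ?_⟩
  rw [Function.Involutive.coe_toPerm]
  by_cases h1 : i ∈ F
  · have : f i = i := by simp [f, h1, hi]
    rw [this]
    exact ⟨h1, le_rfl⟩
  · have h2 : i ∈ A \ F := by simp [hi, h1]
    have : f i = e ⟨i, h2⟩ := dif_pos h2
    rw [this]
    have h3 := Finset.mem_sdiff.1 (he1 i h2)
    exact ⟨h3.1, h _ h3.1 _ hi h1⟩

lemma sum_le_sum_of_perm {w : Fin K → ℝ} {A F : Finset (Fin K)} (hcard : A.card = F.card)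
    {σ : Equiv.Perm (Fin K)} (h : ∀ i ∈ A, σ i ∈ F ∧ w (σ i) ≤ w i) :
    ∑ k ∈ F, w k ≤ ∑ k ∈ A, w k := by
  have hF : A.map σ.toEmbedding = F := by
    apply Finset.eq_of_subset_of_card_le
    · intro i hi
      obtain ⟨j, hj, rfl⟩ := Finset.mem_map.1 hi
      exact (h j hj).1
    · rw [Finset.card_map, hcard]
  rw [← hF, Finset.sum_map]
  exact Finset.sum_le_sum fun i hi => (h i hi).2

/-- The size of the set selected by the one-step rule. -/
noncomputable def selectSize (α : ℝ) (S : Finset (Fin K)) (w : Fin K → ℝ) : ℕ :=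
  open Classical in
  Nat.findGreatest (fun n => (∑ k ∈ firstElts S w n, w k) / (n : ℝ) ≤ α) S.card

lemma oneStep_eq (α : ℝ) (S : Finset (Fin K)) (w : Fin K → ℝ) :
    oneStep α S w = firstElts S w (selectSize α S w) := rfl

lemma oneStep_subset (α : ℝ) (S : Finset (Fin K)) (w : Fin K → ℝ) : oneStep α S w ⊆ S :=
  firstElts_subset _ _ _

lemma sum_oneStep_le {α : ℝ} (hα : 0 ≤ α) (S : Finset (Fin K)) (w : Fin K → ℝ) :
    ∑ k ∈ oneStep α S w, w k ≤ α * (oneStep α S w).card := by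
  classical
  have h1 : selectSize α S w ≤ S.card := Nat.findGreatest_le _
  -- Size `0` is always admissible, since `R_0 = 0 / 0 = 0 ≤ α`; it is the witness required by
  -- `findGreatest_spec`.
  have h2 : (∑ k ∈ firstElts S w (selectSize α S w), w k) / (selectSize α S w : ℝ) ≤ α :=
    Nat.findGreatest_spec (P := fun n => (∑ k ∈ firstElts S w n, w k) / (n : ℝ) ≤ α)
      (Nat.zero_le _) (by simpa using hα)
  rw [oneStep_eq, card_firstElts h1]
  rcases Nat.eq_zero_or_pos (selectSize α S w) with h0 | h0
  · simp [h0, firstElts_eq]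
  · exact (div_le_iff₀ (by exact_mod_cast h0)).1 h2

lemma firstElts_congr {S : Finset (Fin K)} {w w' : Fin K → ℝ} (h : ∀ k ∈ S, w k = w' k) (n : ℕ) :
    firstElts S w n = firstElts S w' n := by
  simp only [firstElts]
  refine Finset.filter_congr fun k hk => ?_
  have : ({j ∈ S | w j < w k ∨ (w j = w k ∧ j < k)} : Finset (Fin K))
      = {j ∈ S | w' j < w' k ∨ (w' j = w' k ∧ j < k)} :=
    Finset.filter_congr fun j hj => by rw [h j hj, h k hk]
  rw [this]

/-- Allows the posteriors to be replaced by versions that agree with them on active streams only. -/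
lemma oneStep_congr {α : ℝ} {S : Finset (Fin K)} {w w' : Fin K → ℝ} (h : ∀ k ∈ S, w k = w' k) :
    oneStep α S w = oneStep α S w' := by
  have : selectSize α S w = selectSize α S w' := by
    simp only [selectSize]
    congr 1
    ext n
    rw [firstElts_congr h, Finset.sum_congr rfl fun k hk => h k (firstElts_subset _ _ _ hk)]
  rw [oneStep_eq, oneStep_eq, this, firstElts_congr h]

/-- Streams `k` with `x k ≤ 1` are active; deactivated streams carry the value `2`. -/
noncomputable def active (x : Fin K → ℝ) : Finset (Fin K) := {k | x k ≤ 1}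

/-- Deactivate all streams outside `A`. -/
noncomputable def mask (A : Finset (Fin K)) (x : Fin K → ℝ) : Fin K → ℝ :=
  fun k => if k ∈ A then x k else 2

/-- The one-step rule acting on states. -/
noncomputable def stepState (α : ℝ) (x : Fin K → ℝ) : Fin K → ℝ :=
  mask (oneStep α (active x) x) x

lemma stepState_le_two (α : ℝ) (x : Fin K → ℝ) (k : Fin K) : stepState α x k ≤ 2 := by
  unfold stepState mask
  split_ifs with h
  · have := oneStep_subset _ _ _ h
    simp only [active, Finset.mem_filter_univ] at this
    linarith
  · exact le_rfl

/-- The one-step rule dominates every admissible selection from a less favourable state. -/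
lemma exists_perm_stepState_le {α : ℝ} (hα : 0 ≤ α) {u v : Fin K → ℝ} {π : Equiv.Perm (Fin K)}
    (huv : ∀ i, u (π i) ≤ v i) {S : Finset (Fin K)} (hS : S ⊆ active v)
    (hsum : ∑ k ∈ S, v k ≤ α * S.card) :
    ∃ σ : Equiv.Perm (Fin K), ∀ i, stepState α u (σ i) ≤ mask S v i := by
  classical
  -- Transported by `π`, the competing selection becomes a set of `|S|` active streams of `u`; the
  -- `|S|` smallest active coordinates of `u` have a sum that is no larger.
  set A := S.map π.toEmbedding with hA
  have hAcard : A.card = S.card := Finset.card_map _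
  have hAact : A ⊆ active u := by
    intro i hi
    obtain ⟨j, hj, rfl⟩ := Finset.mem_map.1 hi
    have := hS hj
    simp only [active, Finset.mem_filter_univ] at this ⊢
    exact (huv j).trans this
  have hle : S.card ≤ (active u).card := hAcard ▸ Finset.card_le_card hAact
  set F := firstElts (active u) u S.card with hF
  have hFcard : A.card = F.card := by rw [hAcard, hF, card_firstElts hle]
  obtain ⟨σ, hσ⟩ := exists_perm_exchange (w := u) hFcard
    (fun k hk j hj hj' => weight_le_of_mem_firstElts hk (hAact hj) hj')
  -- The sum of `u` over `F` is at most that over `A`, which is at most the sum of `v` over `S`,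
  -- hence at most `α |S|`. So the size `|S|` passes the test and the rule keeps all of `F`.
  have hN : S.card ≤ selectSize α (active u) u := by
    refine Nat.le_findGreatest hle ?_
    rcases Nat.eq_zero_or_pos S.card with h0 | h0
    · simp [h0, hα]
    · rw [div_le_iff₀ (by exact_mod_cast h0)]
      refine (sum_le_sum_of_perm hFcard hσ).trans (le_trans ?_ hsum)
      rw [hA, Finset.sum_map]
      exact Finset.sum_le_sum fun i _ => huv i
  refine ⟨π.trans σ, fun i => ?_⟩
  by_cases hi : i ∈ S
  · have h1 := hσ (π i) (Finset.mem_map.2 ⟨i, hi, rfl⟩)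
    have h2 : σ (π i) ∈ oneStep α (active u) u := firstElts_mono _ _ hN h1.1
    simp only [stepState, mask, hi, Equiv.trans_apply, h2, if_true]
    exact h1.2.trans (huv i)
  -- Outside `S` the competitor carries `2`, which no value produced by the rule exceeds.
  · simp only [mask, hi, if_false]
    exact stepState_le_two _ _ _

/-- Symmetric functions of the state which decrease in each coordinate. -/
def SymmAntitone (f : (Fin K → ℝ) → ℝ≥0∞) : Prop :=
  ∀ (x y : Fin K → ℝ) (π : Equiv.Perm (Fin K)), (∀ i, x (π i) ≤ y i) → f y ≤ f x

lemma SymmAntitone.comp_stepState {f : (Fin K → ℝ) → ℝ≥0∞} (hf : SymmAntitone f) {α : ℝ}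
    (hα : 0 ≤ α) : SymmAntitone (fun x => f (stepState α x)) := by
  intro x y π h
  obtain ⟨σ, hσ⟩ := exists_perm_stepState_le hα h (oneStep_subset α (active y) y)
    (sum_oneStep_le hα _ _)
  exact hf _ _ σ hσ

lemma SymmAntitone.mask_le_stepState {f : (Fin K → ℝ) → ℝ≥0∞} (hf : SymmAntitone f) {α : ℝ}
    (hα : 0 ≤ α) {x : Fin K → ℝ} {S : Finset (Fin K)} (hS : S ⊆ active x)
    (hsum : ∑ k ∈ S, x k ≤ α * S.card) : f (mask S x) ≤ f (stepState α x) := by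
  obtain ⟨σ, hσ⟩ := exists_perm_stepState_le (π := 1) hα (fun i => le_rfl) hS hsum
  exact hf _ _ σ hσ

lemma symmAntitone_sum {φ : ℝ → ℝ≥0∞} (hφ : Antitone φ) :
    SymmAntitone (fun x : Fin K → ℝ => ∑ k, φ (x k)) := by
  intro x y π h
  calc ∑ k, φ (y k) ≤ ∑ k, φ (x (π k)) := Finset.sum_le_sum fun i _ => hφ (h i)
    _ = ∑ k, φ (x k) := Equiv.sum_comp π fun k => φ (x k)

lemma mask_mask (A B : Finset (Fin K)) (h : B ⊆ A) (x : Fin K → ℝ) :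
    mask B (mask A x) = mask B x := by
  ext k
  by_cases hk : k ∈ B
  · simp [mask, hk, h hk]
  · simp [mask, hk]

lemma active_mask {A : Finset (Fin K)} {x : Fin K → ℝ} (hx : ∀ k, x k ≤ 1) :
    active (mask A x) = A := by
  ext k
  rw [active, Finset.mem_filter_univ, mask]
  by_cases hk : k ∈ A <;> simp [hk, hx k]

lemma stepState_mask {α : ℝ} {A : Finset (Fin K)} {x : Fin K → ℝ} (hx : ∀ k, x k ≤ 1) :
    stepState α (mask A x) = mask (oneStep α A x) x := by
  have h : oneStep α A (mask A x) = oneStep α A x :=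
    oneStep_congr fun k hk => by simp [mask, hk]
  rw [stepState, active_mask hx, h, mask_mask _ _ (oneStep_subset _ _ _)]

/-- Discrete, in agreement with the `⊤` that appears in `stepSigma`. -/
instance : MeasurableSpace (Finset (Fin K)) := ⊤

instance : DiscreteMeasurableSpace (Finset (Fin K)) := ⟨fun _ => trivial⟩

lemma measurable_finset_iff {Ω : Type*} [MeasurableSpace Ω] {S : Ω → Finset (Fin K)} :
    Measurable S ↔ ∀ k, MeasurableSet {ω | k ∈ S ω} := by
  refine ⟨fun h k => h (MeasurableSet.of_discrete (s := {A : Finset (Fin K) | k ∈ A})),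
    fun h => ?_⟩
  refine measurable_to_countable' fun A => ?_
  have : S ⁻¹' {A} = ⋂ k, {ω | k ∈ S ω ↔ k ∈ A} := by
    ext ω
    simp [Finset.ext_iff]
  rw [this]
  refine MeasurableSet.iInter fun k => ?_
  by_cases hk : k ∈ A
  · simpa [hk] using h k
  · simpa [hk, Set.compl_def] using (h k).compl

lemma measurable_firstElts (S : Finset (Fin K)) (n : ℕ) :
    Measurable (fun w => firstElts S w n) := by
  have hpre (k : Fin K) : Measurable fun w : Fin K → ℝ =>
      ({j ∈ S | w j < w k ∨ (w j = w k ∧ j < k)} : Finset (Fin K)) := by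
    rw [measurable_finset_iff]
    intro j
    simp only [Finset.mem_filter]
    measurability
  rw [measurable_finset_iff]
  intro k
  simp only [firstElts, Finset.mem_filter]
  refine MeasurableSet.inter (MeasurableSet.const _) ?_
  exact hpre k (MeasurableSet.of_discrete (s := {A : Finset (Fin K) | A.card < n}))

lemma measurable_selectSize (α : ℝ) (S : Finset (Fin K)) :
    Measurable (fun w => selectSize α S w) := by
  classical
  refine measurable_findGreatest fun n _ => ?_
  have h : Measurable fun w : Fin K → ℝ => ∑ k ∈ firstElts S w n, w k := by
    have : (fun w : Fin K → ℝ => ∑ k ∈ firstElts S w n, w k)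
        = fun w => ∑ k, ({w | k ∈ firstElts S w n}.indicator (fun w => w k) w) := by
      ext w
      simp [Set.indicator_apply, Finset.sum_ite_mem]
    rw [this]
    refine Finset.measurable_sum _ fun k _ => Measurable.indicator (by fun_prop) ?_
    exact measurable_finset_iff.1 (measurable_firstElts S n) k
  exact measurableSet_le (h.div_const _) measurable_const

lemma measurable_oneStep (α : ℝ) (S : Finset (Fin K)) :
    Measurable (fun w => oneStep α S w) := by
  rw [measurable_finset_iff]
  intro k
  have : {w : Fin K → ℝ | k ∈ oneStep α S w}
      = ⋃ n, ({w | selectSize α S w = n} ∩ {w | k ∈ firstElts S w n}) := by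
    ext w
    simp [oneStep_eq]
  rw [this]
  exact MeasurableSet.iUnion fun n =>
    (measurable_selectSize α S (measurableSet_singleton n)).inter
      (measurable_finset_iff.1 (measurable_firstElts S n) k)

lemma measurable_mask (A : Finset (Fin K)) : Measurable (mask A) := by
  refine measurable_pi_lambda _ fun k => ?_
  by_cases hk : k ∈ A
  · simpa [mask, hk] using measurable_pi_apply k
  · simp [mask, hk]

lemma measurable_active : Measurable (active (K := K)) := by
  rw [measurable_finset_iff]
  intro k
  simp only [active, Finset.mem_filter_univ]
  exact measurableSet_le (measurable_pi_apply k) measurable_const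

/-- Patch measurable functions along a measurable finite partition. -/
lemma measurable_of_finset_partition {Ω β : Type*} [MeasurableSpace Ω] [MeasurableSpace β]
    {S : Ω → Finset (Fin K)} (hS : Measurable S) {F : Finset (Fin K) → Ω → β}
    (hF : ∀ A, Measurable (F A)) : Measurable (fun ω => F (S ω) ω) := by
  intro s hs
  have : (fun ω => F (S ω) ω) ⁻¹' s = ⋃ A, (S ⁻¹' {A} ∩ F A ⁻¹' s) := by
    ext ω
    simp
  rw [this]
  exact MeasurableSet.iUnion fun A => (hS (measurableSet_singleton A)).inter (hF A hs)

lemma measurable_stepState (α : ℝ) : Measurable (stepState (K := K) α) := by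
  have h : Measurable fun x : Fin K → ℝ => oneStep α (active x) x :=
    measurable_of_finset_partition measurable_active (F := fun A x => oneStep α A x)
      fun A => measurable_oneStep α A
  exact measurable_of_finset_partition h (F := fun A x => mask A x) measurable_mask

end Selection

/-! ### The Markov operator of the posteriors and its stochastic monotonicity. -/

section Transition

variable {E : Type*} [MeasurableSpace E] {K : ℕ}

/-- Two probability densities with respect to a probability measure. -/
structure IsDensityPair (ν : Measure E) (a b : E → ℝ) : Prop where
  measurable_fst : Measurable a
  measurable_snd : Measurable b
  fst_nonneg : ∀ y, 0 ≤ a y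
  snd_nonneg : ∀ y, 0 ≤ b y
  lintegral_fst : ∫⁻ y, ENNReal.ofReal (a y) ∂ν = 1
  lintegral_snd : ∫⁻ y, ENNReal.ofReal (b y) ∂ν = 1

/-- The probability that the change has happened one time step later. -/
noncomputable def prior (θ x : ℝ) : ℝ := max 0 (min x 1) + (1 - max 0 (min x 1)) * θ

/-- Bayes' rule for two hypotheses with likelihoods `r` and `s`. -/
noncomputable def bayes (v r s : ℝ) : ℝ := v * s / (v * s + (1 - v) * r)

/-- Predictive density of the next observation. -/
noncomputable def predDensity (θ : ℝ) (a b : E → ℝ) (x : ℝ) (y : E) : ℝ≥0∞ :=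
  ENNReal.ofReal (prior θ x * b y + (1 - prior θ x) * a y)

/-- Next state of a stream in state `x` that observes `y`; inactive streams stay inactive. -/
noncomputable def nextState (θ : ℝ) (a b : E → ℝ) (x : ℝ) (y : E) : ℝ :=
  if x ≤ 1 then bayes (prior θ x) (a y) (b y) else 2

/-- The transition operator of the vector of states. -/
noncomputable def transition (ν : Measure E) (θ : ℝ) (a b : E → ℝ)
    (f : (Fin K → ℝ) → ℝ≥0∞) (x : Fin K → ℝ) : ℝ≥0∞ :=
  ∫⁻ y, f (fun k => nextState θ a b (x k) (y k)) * ∏ k, predDensity θ a b (x k) (y k)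
    ∂(Measure.pi fun _ => ν)

lemma prior_mono {θ : ℝ} (hθ1 : θ ≤ 1) : Monotone (prior θ) := by
  intro x y h
  have : max 0 (min x 1) ≤ max 0 (min y 1) := by gcongr
  unfold prior
  nlinarith

/-- The clamp in `prior` makes it a probability for every real state. The inactive state `2` gets
prior `1`, so its predictive density is still normalized. -/
lemma prior_mem {θ : ℝ} (hθ0 : 0 ≤ θ) (hθ1 : θ ≤ 1) (x : ℝ) :
    0 ≤ prior θ x ∧ prior θ x ≤ 1 := by
  have h0 : 0 ≤ max 0 (min x 1) := le_max_left _ _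
  have h1 : max 0 (min x 1) ≤ 1 := max_le zero_le_one (min_le_right _ _)
  unfold prior
  constructor <;> nlinarith

lemma measurable_prior (θ : ℝ) : Measurable (prior θ) := by
  unfold prior; fun_prop

lemma bayes_mem {v r s : ℝ} (hv0 : 0 ≤ v) (hv1 : v ≤ 1) (hr : 0 ≤ r) (hs : 0 ≤ s) :
    0 ≤ bayes v r s ∧ bayes v r s ≤ 1 := by
  have h1 : 0 ≤ v * s := mul_nonneg hv0 hs
  have h2 : 0 ≤ (1 - v) * r := mul_nonneg (by linarith) hr
  exact ⟨div_nonneg h1 (by linarith), div_le_one_of_le₀ (by linarith) (by linarith)⟩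

/-- After cross-multiplication the difference is `(v' - v) r s`. Vanishing denominators occur only
in the case `v s = 0`, where the left side is `0`. -/
lemma bayes_mono {v v' r s : ℝ} (hv0 : 0 ≤ v) (hvv : v ≤ v') (hv1 : v' ≤ 1) (hr : 0 ≤ r)
    (hs : 0 ≤ s) : bayes v r s ≤ bayes v' r s := by
  have h1 : 0 ≤ v * s := mul_nonneg hv0 hs
  have h2 : 0 ≤ (1 - v) * r := mul_nonneg (by linarith) hr
  have h1' : 0 ≤ v' * s := mul_nonneg (by linarith) hs
  have h2' : 0 ≤ (1 - v') * r := mul_nonneg (by linarith) hr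
  have h12 : v * s ≤ v' * s := mul_le_mul_of_nonneg_right hvv hs
  unfold bayes
  rcases eq_or_lt_of_le h1 with h0 | h0
  · rw [← h0, zero_div]
    exact div_nonneg h1' (by linarith)
  · rw [div_le_div_iff₀ (by linarith) (by linarith)]
    have : 0 ≤ (v' - v) * (r * s) := mul_nonneg (by linarith) (mul_nonneg hr hs)
    nlinarith

/-- Positivity of the denominator matters: `0 / 0 = 0` may lie below `v`. The opposite bound
`bayes_le` needs no such assumption. -/
lemma le_bayes {v r s : ℝ} (hv0 : 0 ≤ v) (h : r ≤ s)
    (hv1 : v ≤ 1) (hpos : 0 < v * s + (1 - v) * r) : v ≤ bayes v r s := by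
  rw [bayes, le_div_iff₀ hpos]
  nlinarith [mul_nonneg hv0 (mul_nonneg (sub_nonneg.2 hv1) (sub_nonneg.2 h))]

lemma bayes_le {v r s : ℝ} (hv0 : 0 ≤ v) (hr : 0 ≤ r) (hs : 0 ≤ s) (h : s ≤ r) (hv1 : v ≤ 1) :
    bayes v r s ≤ v := by
  have h1 : 0 ≤ v * s := mul_nonneg hv0 hs
  have h2 : 0 ≤ (1 - v) * r := mul_nonneg (by linarith) hr
  refine div_le_of_le_mul₀ (by linarith) hv0 ?_
  nlinarith [mul_nonneg hv0 (mul_nonneg (sub_nonneg.2 hv1) (sub_nonneg.2 h))]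

variable {ν : Measure E} {a b : E → ℝ} {θ : ℝ}

lemma measurable_predDensity (h : IsDensityPair ν a b) :
    Measurable (Function.uncurry (predDensity θ a b)) := by
  have ha := h.measurable_fst
  have hb := h.measurable_snd
  have hp := measurable_prior θ
  unfold predDensity Function.uncurry
  fun_prop

lemma measurable_nextState (h : IsDensityPair ν a b) :
    Measurable (Function.uncurry (nextState θ a b)) := by
  have ha := h.measurable_fst
  have hb := h.measurable_snd
  have hp := measurable_prior θ
  unfold nextState Function.uncurry bayes
  refine Measurable.ite (measurableSet_le measurable_fst measurable_const) ?_ measurable_const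
  fun_prop

lemma lintegral_predDensity (h : IsDensityPair ν a b) (hθ0 : 0 ≤ θ) (hθ1 : θ ≤ 1) (x : ℝ) :
    ∫⁻ y, predDensity θ a b x y ∂ν = 1 := by
  obtain ⟨h0, h1⟩ := prior_mem hθ0 hθ1 x
  have ha := h.measurable_fst
  have hb := h.measurable_snd
  have (y : E) : predDensity θ a b x y = ENNReal.ofReal (prior θ x) * ENNReal.ofReal (b y)
      + ENNReal.ofReal (1 - prior θ x) * ENNReal.ofReal (a y) := by
    rw [predDensity, ENNReal.ofReal_add (mul_nonneg h0 (h.snd_nonneg y))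
      (mul_nonneg (by linarith) (h.fst_nonneg y)), ENNReal.ofReal_mul h0,
      ENNReal.ofReal_mul (by linarith)]
  simp_rw [this]
  rw [lintegral_add_left (by fun_prop), lintegral_const_mul _ (by fun_prop),
    lintegral_const_mul _ (by fun_prop), h.lintegral_fst, h.lintegral_snd, mul_one, mul_one,
    ← ENNReal.ofReal_add h0 (by linarith)]
  simp

lemma nextState_le_two (h : IsDensityPair ν a b) (hθ0 : 0 ≤ θ) (hθ1 : θ ≤ 1) (x : ℝ) (y : E) :
    nextState θ a b x y ≤ 2 := by
  obtain ⟨h0, h1⟩ := prior_mem hθ0 hθ1 x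
  unfold nextState
  split_ifs
  · linarith [(bayes_mem h0 h1 (h.fst_nonneg y) (h.snd_nonneg y)).2]
  · exact le_rfl

lemma nextState_mono (h : IsDensityPair ν a b) (hθ0 : 0 ≤ θ) (hθ1 : θ ≤ 1) (y : E) :
    Monotone (fun x => nextState θ a b x y) := by
  intro x x' hx
  obtain ⟨h0, h1⟩ := prior_mem hθ0 hθ1 x
  obtain ⟨h0', h1'⟩ := prior_mem hθ0 hθ1 x'
  by_cases hx' : x' ≤ 1
  · simp only [nextState, hx', hx.trans hx', if_true]
    exact bayes_mono h0 (prior_mono hθ1 hx) h1' (h.fst_nonneg y) (h.snd_nonneg y)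
  · have : nextState θ a b x' y = 2 := if_neg hx'
    simp only [this]
    exact nextState_le_two h hθ0 hθ1 x y

/-- The rearrangement inequality `(s - r)(d - c) ≥ 0`, in a form without subtraction. -/
lemma mul_add_mul_le_of_le {r s c d : ℝ≥0∞} (h1 : r ≤ s) (h2 : c ≤ d) :
    r * d + s * c ≤ r * c + s * d := by
  obtain ⟨e, rfl⟩ := exists_add_of_le h2
  calc r * (c + e) + s * c = r * c + s * c + r * e := by ring
    _ ≤ r * c + s * c + s * e := by gcongr
    _ = r * c + s * (c + e) := by ring

/-- The one-step transition of a single stream is stochastically increasing. -/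
lemma lintegral_nextState_antitone (h : IsDensityPair ν a b) (hθ0 : 0 ≤ θ) (hθ1 : θ ≤ 1)
    {φ : ℝ → ℝ≥0∞} (hφ : Antitone φ) (hfin : ∀ t, φ t ≠ ∞) {x x' : ℝ} (hx : x ≤ x') :
    ∫⁻ y, φ (nextState θ a b x' y) * predDensity θ a b x' y ∂ν
      ≤ ∫⁻ y, φ (nextState θ a b x y) * predDensity θ a b x y ∂ν := by
  have hm := measurable_nextState (θ := θ) h
  have hd := measurable_predDensity (θ := θ) h
  have hφm : Measurable φ := hφ.measurable
  have hn (x : ℝ) : Measurable (nextState θ a b x) := hm.comp measurable_prodMk_left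
  have hdx (x : ℝ) : Measurable (predDensity θ a b x) := hd.comp measurable_prodMk_left
  -- First only the sampling density passes from `x'` to `x`, with the update map of `x'` kept; the
  -- map is changed at the end by monotonicity.
  have hstep : ∫⁻ y, φ (nextState θ a b x' y) * predDensity θ a b x' y ∂ν
      ≤ ∫⁻ y, φ (nextState θ a b x' y) * predDensity θ a b x y ∂ν := by
    by_cases hx1 : x' ≤ 1
    · set v := prior θ x with hv
      set v' := prior θ x' with hv'
      obtain ⟨h0', h1'⟩ := prior_mem hθ0 hθ1 x'
      have hvv : v ≤ v' := prior_mono hθ1 hx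
      -- The predictive densities differ by `(v' - v)(b - a)`, and `bayes v' a b - v'` has the sign
      -- of `b - a` where the density of `v'` is positive. So the increments of `φ` and of the
      -- density have opposite signs. The added terms with `φ v'` avoid subtraction; they have equal
      -- finite integrals and cancel.
      have key : ∫⁻ y, (φ (nextState θ a b x' y) * predDensity θ a b x' y
            + φ v' * predDensity θ a b x y) ∂ν
          ≤ ∫⁻ y, (φ (nextState θ a b x' y) * predDensity θ a b x y
            + φ v' * predDensity θ a b x' y) ∂ν := by
        refine lintegral_mono fun y => ?_
        have ha := h.fst_nonneg y
        have hb := h.snd_nonneg y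
        have hns : nextState θ a b x' y = bayes v' (a y) (b y) := if_pos hx1
        simp only [hns, predDensity]
        rw [← hv, ← hv']
        -- Where the predictive density of `v'` vanishes, `bayes` has the value `0` and `le_bayes`
        -- fails; this case is treated apart.
        by_cases hpos : v' * b y + (1 - v') * a y ≤ 0
        · have hz := ENNReal.ofReal_of_nonpos hpos
          rcases le_total (b y) (a y) with hab | hab
          · have h3 := bayes_le h0' ha hb hab h1'
            rw [hz]
            simp only [mul_zero, zero_add, add_zero]
            gcongr
            exact hφ h3
          · have h4 : v * b y + (1 - v) * a y ≤ 0 := by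
              nlinarith [mul_nonneg (sub_nonneg.2 hvv) (sub_nonneg.2 hab)]
            rw [hz, ENNReal.ofReal_of_nonpos h4]
        · push Not at hpos
          rcases le_total (a y) (b y) with hab | hab
          · have h1 := hφ (le_bayes h0' hab h1' hpos)
            have h2 : v * b y + (1 - v) * a y ≤ v' * b y + (1 - v') * a y := by
              nlinarith [mul_nonneg (sub_nonneg.2 hvv) (sub_nonneg.2 hab)]
            exact mul_add_mul_le_of_le h1 (ENNReal.ofReal_le_ofReal h2)
          · have h1 := hφ (bayes_le h0' ha hb hab h1')
            have h2 : v' * b y + (1 - v') * a y ≤ v * b y + (1 - v) * a y := by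
              nlinarith [mul_nonneg (sub_nonneg.2 hvv) (sub_nonneg.2 hab)]
            have := mul_add_mul_le_of_le h1 (ENNReal.ofReal_le_ofReal h2)
            rwa [add_comm, add_comm (φ v' * _)] at this
      rw [lintegral_add_right _ ((hdx x).const_mul _), lintegral_const_mul _ (hdx x),
        lintegral_add_right _ ((hdx x').const_mul _), lintegral_const_mul _ (hdx x'),
        lintegral_predDensity h hθ0 hθ1, lintegral_predDensity h hθ0 hθ1] at key
      exact (ENNReal.add_le_add_iff_right (by simpa using hfin _)).1 key
    · have (y : E) : nextState θ a b x' y = 2 := if_neg hx1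
      simp only [this]
      rw [lintegral_const_mul _ (hdx x), lintegral_const_mul _ (hdx x'),
        lintegral_predDensity h hθ0 hθ1, lintegral_predDensity h hθ0 hθ1]
  refine hstep.trans (lintegral_mono fun y => ?_)
  gcongr
  exact hφ (nextState_mono h hθ0 hθ1 y hx)

lemma measurable_nextState_pi (h : IsDensityPair ν a b) :
    Measurable fun p : (Fin K → ℝ) × (Fin K → E) =>
      (fun k => nextState θ a b (p.1 k) (p.2 k) : Fin K → ℝ) :=
  measurable_pi_lambda _ fun k => (measurable_nextState (θ := θ) h).comp
    (f := fun p : (Fin K → ℝ) × (Fin K → E) => (p.1 k, p.2 k)) (by fun_prop)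

lemma measurable_transition_integrand (h : IsDensityPair ν a b) {f : (Fin K → ℝ) → ℝ≥0∞}
    (hf : Measurable f) : Measurable fun p : (Fin K → ℝ) × (Fin K → E) =>
      f (fun k => nextState θ a b (p.1 k) (p.2 k))
        * ∏ k, predDensity θ a b (p.1 k) (p.2 k) := by
  refine (hf.comp (measurable_nextState_pi h)).mul (Finset.measurable_prod _ fun k _ => ?_)
  exact (measurable_predDensity (θ := θ) h).comp
    (f := fun p : (Fin K → ℝ) × (Fin K → E) => (p.1 k, p.2 k)) (by fun_prop)

lemma lintegral_pi_prod {F : Fin K → E → ℝ≥0∞} (hF : ∀ k, Measurable (F k))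
    (ρ : Fin K → Measure E) [∀ k, IsProbabilityMeasure (ρ k)] :
    ∫⁻ y, ∏ k, F k (y k) ∂(Measure.pi ρ) = ∏ k, ∫⁻ y, F k y ∂(ρ k) := by
  have hind := iIndepFun_pi (μ := ρ) (X := F) (fun k => (hF k).aemeasurable)
  rw [lintegral_prod_eq_prod_lintegral_of_indepFun Finset.univ _ hind
    (fun k => (hF k).comp (measurable_pi_apply k))]
  refine Finset.prod_congr rfl fun k _ => ?_
  exact (measurePreserving_eval ρ k).lintegral_comp (hF k)

lemma measurable_prod_predDensity (h : IsDensityPair ν a b) (x : Fin K → ℝ) :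
    Measurable fun y : Fin K → E => ∏ k, predDensity θ a b (x k) (y k) :=
  Finset.measurable_prod _ fun k _ => (measurable_predDensity (θ := θ) h).comp
    (measurable_const.prodMk (measurable_pi_apply k))

variable [IsProbabilityMeasure ν]

lemma lintegral_prod_predDensity (h : IsDensityPair ν a b) (hθ0 : 0 ≤ θ) (hθ1 : θ ≤ 1)
    (x : Fin K → ℝ) :
    ∫⁻ y, ∏ k, predDensity θ a b (x k) (y k) ∂(Measure.pi fun _ => ν) = 1 := by
  rw [lintegral_pi_prod (F := fun k => predDensity θ a b (x k))
    fun k => (measurable_predDensity h).comp measurable_prodMk_left]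
  simp [lintegral_predDensity h hθ0 hθ1]

/-- Comparison of two integrals against product densities that differ in one coordinate only. -/
lemma lintegral_mul_prod_predDensity_le (h : IsDensityPair ν a b) {F F' : (Fin K → E) → ℝ≥0∞}
    (hF : Measurable F) (hF' : Measurable F') {x x' : Fin K → ℝ} (i : Fin K)
    (hx : ∀ j, j ≠ i → x j = x' j)
    (hi : ∀ y, ∫⁻ t, F (Function.update y i t) * predDensity θ a b (x i) t ∂ν
      ≤ ∫⁻ t, F' (Function.update y i t) * predDensity θ a b (x' i) t ∂ν) :
    ∫⁻ y, F y * ∏ k, predDensity θ a b (x k) (y k) ∂(Measure.pi fun _ => ν)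
      ≤ ∫⁻ y, F' y * ∏ k, predDensity θ a b (x' k) (y k) ∂(Measure.pi fun _ => ν) := by
  have hd (r : ℝ) : Measurable (predDensity θ a b r) :=
    (measurable_predDensity h).comp measurable_prodMk_left
  refine lintegral_le_of_lmarginal_le {i} (hF.mul (measurable_prod_predDensity h x))
    (hF'.mul (measurable_prod_predDensity h x')) ?_
  intro y
  simp only [lmarginal_singleton]
  have split (x : Fin K → ℝ) (t : E) :
      ∏ k, predDensity θ a b (x k) (Function.update y i t k)
        = predDensity θ a b (x i) t * ∏ k ∈ Finset.univ.erase i, predDensity θ a b (x k) (y k) := by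
    rw [← Finset.mul_prod_erase _ _ (Finset.mem_univ i), Function.update_self]
    congr 1
    refine Finset.prod_congr rfl fun k hk => ?_
    rw [Function.update_of_ne (Finset.ne_of_mem_erase hk)]
  have hprod : ∏ k ∈ Finset.univ.erase i, predDensity θ a b (x k) (y k)
      = ∏ k ∈ Finset.univ.erase i, predDensity θ a b (x' k) (y k) :=
    Finset.prod_congr rfl fun k hk => by rw [hx k (Finset.ne_of_mem_erase hk)]
  simp only [split, ← mul_assoc]
  have hm {G : (Fin K → E) → ℝ≥0∞} (hG : Measurable G) (r : ℝ) :
      Measurable fun t => G (Function.update y i t) * predDensity θ a b r t :=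
    (hG.comp (measurable_update _)).mul (hd r)
  rw [lintegral_mul_const _ (hm hF _), lintegral_mul_const _ (hm hF' _), hprod]
  exact mul_le_mul_left (hi y) _

lemma measurable_transition (h : IsDensityPair ν a b) {f : (Fin K → ℝ) → ℝ≥0∞}
    (hf : Measurable f) : Measurable (transition ν θ a b f) :=
  (measurable_transition_integrand h hf).lintegral_prod_right'

lemma transition_le (h : IsDensityPair ν a b) (hθ0 : 0 ≤ θ) (hθ1 : θ ≤ 1)
    {f : (Fin K → ℝ) → ℝ≥0∞} {C : ℝ≥0∞} (hC : ∀ x, f x ≤ C) (x : Fin K → ℝ) :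
    transition ν θ a b f x ≤ C := by
  calc transition ν θ a b f x
      ≤ ∫⁻ y, C * ∏ k, predDensity θ a b (x k) (y k) ∂(Measure.pi fun _ => ν) := by
        refine lintegral_mono fun y => ?_
        gcongr
        exact hC _
    _ = C := by
        rw [lintegral_const_mul _ (measurable_prod_predDensity h x),
          lintegral_prod_predDensity h hθ0 hθ1, mul_one]

lemma SymmAntitone.comp_perm {f : (Fin K → ℝ) → ℝ≥0∞} (hf : SymmAntitone f) (x : Fin K → ℝ)
    (π : Equiv.Perm (Fin K)) : f (fun i => x (π i)) = f x :=
  le_antisymm (hf _ _ π fun _ => le_rfl) (hf _ _ π.symm fun i => by simp)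

/-- The product measure is invariant under relabelling the observations by `π`, and `f` is
symmetric. -/
lemma transition_comp_perm {f : (Fin K → ℝ) → ℝ≥0∞} (hf : SymmAntitone f)
    (x : Fin K → ℝ) (π : Equiv.Perm (Fin K)) :
    transition ν θ a b f (fun i => x (π i)) = transition ν θ a b f x := by
  have hmp := measurePreserving_piCongrLeft (fun _ : Fin K => ν) π
  unfold transition
  symm
  rw [← hmp.lintegral_comp_emb (MeasurableEquiv.measurableEmbedding _)]
  refine lintegral_congr fun y => ?_
  have hy (k : Fin K) : MeasurableEquiv.piCongrLeft (fun _ : Fin K => E) π y (π k) = y k :=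
    MeasurableEquiv.piCongrLeft_apply_apply (β := fun _ => E) π y k
  rw [← hf.comp_perm _ π, ← Equiv.prod_comp π]
  simp only [hy]

/-- With the observations of the other streams frozen, `f` is a decreasing function of the next
state of stream `i` alone, and the one-stream comparison applies. -/
lemma transition_update_le (h : IsDensityPair ν a b) (hθ0 : 0 ≤ θ) (hθ1 : θ ≤ 1)
    {f : (Fin K → ℝ) → ℝ≥0∞} (hf : SymmAntitone f) (hm : Measurable f) (hfin : ∀ x, f x ≠ ∞)
    (x : Fin K → ℝ) (i : Fin K) {r : ℝ} (hr : x i ≤ r) :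
    transition ν θ a b f (Function.update x i r) ≤ transition ν θ a b f x := by
  have hmx (x : Fin K → ℝ) : Measurable fun y : Fin K → E =>
      f (fun k => nextState θ a b (x k) (y k)) :=
    hm.comp ((measurable_nextState_pi h).comp measurable_prodMk_left)
  refine lintegral_mul_prod_predDensity_le h (hmx _) (hmx _) i
    (fun j hj => Function.update_of_ne hj _ _) fun y => ?_
  let φ : ℝ → ℝ≥0∞ := fun s =>
    f (Function.update (fun k => nextState θ a b (x k) (y k)) i s)
  have hφ : Antitone φ := fun s s' hs => hf _ _ 1 fun j => by
    by_cases hj : j = i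
    · subst hj; simpa using hs
    · simp [hj]
  have e1 (x' : Fin K → ℝ) (hx' : ∀ j, j ≠ i → x' j = x j) (t : E) :
      f (fun k => nextState θ a b (x' k) (Function.update y i t k))
        = φ (nextState θ a b (x' i) t) := by
    simp only [φ]
    congr 1
    ext k
    by_cases hk : k = i
    · subst hk; simp
    · simp [hk, hx' k hk]
  simp only [e1 x (fun _ _ => rfl), e1 _ (fun j hj => Function.update_of_ne hj r x),
    Function.update_self]
  exact lintegral_nextState_antitone h hθ0 hθ1 hφ (fun _ => hfin _) hr

lemma transition_antitone (h : IsDensityPair ν a b) (hθ0 : 0 ≤ θ) (hθ1 : θ ≤ 1)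
    {f : (Fin K → ℝ) → ℝ≥0∞} (hf : SymmAntitone f) (hm : Measurable f) (hfin : ∀ x, f x ≠ ∞) :
    Antitone (transition ν θ a b f) := by
  intro x y hxy
  -- The coordinates are raised from `x` to `y` one at a time.
  have (s : Finset (Fin K)) :
      transition ν θ a b f (s.piecewise y x) ≤ transition ν θ a b f x := by
    induction s using Finset.induction_on with
    | empty => simp
    | insert i s hi ih =>
      rw [Finset.piecewise_insert]
      refine (transition_update_le h hθ0 hθ1 hf hm hfin _ i ?_).trans ih
      simpa [hi] using hxy i
  simpa using this Finset.univ

lemma SymmAntitone.transition (h : IsDensityPair ν a b) (hθ0 : 0 ≤ θ) (hθ1 : θ ≤ 1)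
    {f : (Fin K → ℝ) → ℝ≥0∞} (hf : SymmAntitone f) (hm : Measurable f) (hfin : ∀ x, f x ≠ ∞) :
    SymmAntitone (transition ν θ a b f) := by
  intro x y π hxy
  rw [← transition_comp_perm hf x π]
  exact transition_antitone h hθ0 hθ1 hf hm hfin hxy

/-- The predictive densities of masked streams integrate out. -/
lemma transition_mask (h : IsDensityPair ν a b) (hθ0 : 0 ≤ θ) (hθ1 : θ ≤ 1)
    {f : (Fin K → ℝ) → ℝ≥0∞} (hm : Measurable f) (A : Finset (Fin K)) (x : Fin K → ℝ) :
    transition ν θ a b (fun z => f (mask A z)) x = transition ν θ a b f (mask A x) := by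
  have hmask (y : Fin K → E) : mask A (fun k => nextState θ a b (x k) (y k))
      = fun k => nextState θ a b (mask A x k) (y k) := by
    ext k
    by_cases hk : k ∈ A <;> simp [mask, nextState, hk]
  unfold transition
  simp only [hmask]
  set F : (Fin K → E) → ℝ≥0∞ := fun y => f (fun k => nextState θ a b (mask A x k) (y k)) with hFdef
  have hF : Measurable F := hm.comp ((measurable_nextState_pi h).comp measurable_prodMk_left)
  have hFc (y : Fin K → E) (i : Fin K) (hi : i ∉ A) (t : E) :
      F (Function.update y i t) = F y := by
    simp only [hFdef]
    congr 1
    ext k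
    by_cases hk : k = i
    · subst hk; simp [mask, hi, nextState]
    · simp [hk]
  have hd (r : ℝ) : Measurable (predDensity θ a b r) :=
    (measurable_predDensity h).comp measurable_prodMk_left
  -- `F` ignores the observations outside `A`, and predictive densities integrate to one in every
  -- state. So the states outside `A` may be replaced by `2` one after the other.
  have key (s : Finset (Fin K)) (hs : s ⊆ Aᶜ) :
      ∫⁻ y, F y * ∏ k, predDensity θ a b (x k) (y k) ∂(Measure.pi fun _ => ν)
        = ∫⁻ y, F y * ∏ k, predDensity θ a b (s.piecewise (fun _ => 2) x k) (y k)
          ∂(Measure.pi fun _ => ν) := by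
    induction s using Finset.induction_on with
    | empty => simp
    | insert i s hi ih =>
      rw [ih ((Finset.subset_insert i s).trans hs), Finset.piecewise_insert]
      have hiA : i ∉ A := by simpa using hs (Finset.mem_insert_self i s)
      have e (y : Fin K → E) (r : ℝ) :
          ∫⁻ t, F (Function.update y i t) * predDensity θ a b r t ∂ν = F y := by
        simp only [hFc y i hiA]
        rw [lintegral_const_mul _ (hd r), lintegral_predDensity h hθ0 hθ1, mul_one]
      refine le_antisymm ?_ ?_
      · exact lintegral_mul_prod_predDensity_le h hF hF i
          (fun j hj => (Function.update_of_ne hj _ _).symm) fun y => by rw [e, e]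
      · exact lintegral_mul_prod_predDensity_le h hF hF i
          (fun j hj => (Function.update_of_ne hj _ _)) fun y => by rw [e, e]
  rw [key Aᶜ subset_rfl]
  have : Aᶜ.piecewise (fun _ => (2 : ℝ)) x = mask A x := by
    ext k
    by_cases hk : k ∈ A <;> simp [mask, hk, Finset.piecewise]
  rw [this]

end Transition

/-! ### A single stream: its law, resampling of one observation, memorylessness. -/

section Stream

variable {E : Type*} [MeasurableSpace E]

/-- The σ-algebra of the first `t` coordinates of a path. -/
@[reducible] def pathSigma (E : Type*) [MeasurableSpace E] (t : ℕ) : MeasurableSpace (ℕ → E) :=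
  MeasurableSpace.comap (fun z (s : Fin t) => z s) MeasurableSpace.pi

lemma pathSigma_le (t : ℕ) : pathSigma E t ≤ MeasurableSpace.pi := by
  rw [← measurable_iff_comap_le]
  fun_prop

lemma pathSigma_mono {s t : ℕ} (h : s ≤ t) : pathSigma E s ≤ pathSigma E t := by
  have h1 : Measurable[pathSigma E t] (fun (z : ℕ → E) (i : Fin t) => z i) :=
    comap_measurable _
  have h2 : Measurable (fun (u : Fin t → E) (i : Fin s) => u ⟨i, i.2.trans_le h⟩) := by fun_prop
  exact measurable_iff_comap_le.1 (h2.comp h1)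

lemma measurable_pathSigma_eval {s t : ℕ} (h : s < t) :
    Measurable[pathSigma E t] (fun z : ℕ → E => z s) := by
  have h1 : Measurable[pathSigma E t] (fun (z : ℕ → E) (i : Fin t) => z i) :=
    comap_measurable _
  exact (measurable_pi_apply (⟨s, h⟩ : Fin t)).comp h1

lemma apply_update_of_measurable {t : ℕ} {β : Type*} [MeasurableSpace β]
    [MeasurableSingletonClass β] {φ : (ℕ → E) → β} (hφ : Measurable[pathSigma E t] φ)
    (z : ℕ → E) (y : E) : φ (Function.update z t y) = φ z := by
  refine hφ.factorsThrough (?_ : (fun s : Fin t => Function.update z t y s) = fun s : Fin t => z s)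
  ext s
  rw [Function.update_of_ne s.2.ne]

lemma measurable_update_path (t : ℕ) :
    Measurable fun p : (ℕ → E) × E => Function.update p.1 t p.2 := by
  refine measurable_pi_lambda _ fun s => ?_
  by_cases hs : s = t
  · subst hs; simpa using measurable_snd
  · simp only [Function.update_of_ne hs]; fun_prop

/-- Once coordinate `t` is integrated out, only coordinates `0, …, t - 1` remain; the proof factors
through `Fin t → E` and appends the integrated coordinate with `Fin.snoc`. -/
lemma measurable_lintegral_update {t : ℕ} {φ : (ℕ → E) → ℝ≥0∞}
    (hφ : Measurable[pathSigma E (t + 1)] φ) (κ : Measure E) [SFinite κ] {c : E → ℝ≥0∞}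
    (hc : Measurable c) :
    Measurable[pathSigma E t] fun z => ∫⁻ y, φ (Function.update z t y) * c y ∂κ := by
  obtain ⟨φ', hφ', rfl⟩ := hφ.exists_eq_measurable_comp
  have hsnoc : Measurable fun p : (Fin t → E) × E => (Fin.snoc p.1 p.2 : Fin (t + 1) → E) := by
    refine measurable_pi_lambda _ fun s => ?_
    refine Fin.lastCases ?_ (fun i => ?_) s
    · simpa using measurable_snd
    · simp only [Fin.snoc_castSucc]; fun_prop
  have hg : Measurable fun u : Fin t → E =>
      ∫⁻ y, φ' (Fin.snoc u y : Fin (t + 1) → E) * c y ∂κ :=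
    Measurable.lintegral_prod_right' (f := fun p : (Fin t → E) × E =>
      φ' (Fin.snoc p.1 p.2 : Fin (t + 1) → E) * c p.2) ((hφ'.comp hsnoc).mul (by fun_prop))
  convert hg.comp (comap_measurable fun (z : ℕ → E) (s : Fin t) => z s) using 1
  ext z
  simp only [Function.comp_apply]
  refine lintegral_congr fun y => ?_
  congr 2
  ext s
  refine Fin.lastCases ?_ (fun i => ?_) s
  · simp
  · simp [Function.update_of_ne i.2.ne]

/-- The posterior probability that the change in a single stream has occurred before time `t`,
given the observations `z 0, …, z (t - 1)` made at times `1, …, t`. -/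
noncomputable def filt (θ : ℝ) (a b : E → ℝ) : ℕ → (ℕ → E) → ℝ
  | 0 => fun _ => 0
  | t + 1 => fun z => nextState θ a b (filt θ a b t z) (z t)

/-- The law of the observations of a stream given that its change point is `m`. -/
noncomputable def streamLaw (Pp Pq : Measure E) (m : ℕ∞) : Measure (ℕ → E) :=
  Measure.infinitePi fun s : ℕ => if ((s + 1 : ℕ) : ℕ∞) ≤ m then Pp else Pq

instance isProbabilityMeasure_ite (Pp Pq : Measure E) [IsProbabilityMeasure Pp]
    [IsProbabilityMeasure Pq] (c : Prop) [Decidable c] :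
    IsProbabilityMeasure (if c then Pp else Pq) := by
  split_ifs <;> infer_instance

instance (Pp Pq : Measure E) [IsProbabilityMeasure Pp] [IsProbabilityMeasure Pq] (m : ℕ∞) :
    IsProbabilityMeasure (streamLaw Pp Pq m) := by
  unfold streamLaw; infer_instance

/-- The conditional law of the observations of a stream given its change point. -/
noncomputable def streamKernel (Pp Pq : Measure E) : Kernel ℕ∞ (ℕ → E) :=
  ⟨streamLaw Pp Pq, Measurable.of_discrete⟩

instance (Pp Pq : Measure E) [IsProbabilityMeasure Pp] [IsProbabilityMeasure Pq] :
    IsMarkovKernel (streamKernel Pp Pq) :=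
  ⟨fun m => inferInstanceAs (IsProbabilityMeasure (streamLaw Pp Pq m))⟩

/-- The joint law of the change point and the observations of a stream. -/
noncomputable def jointLaw (γ : Measure ℕ∞) (Pp Pq : Measure E) : Measure (ℕ∞ × (ℕ → E)) :=
  γ.compProd (streamKernel Pp Pq)

instance (γ : Measure ℕ∞) [IsProbabilityMeasure γ] (Pp Pq : Measure E) [IsProbabilityMeasure Pp]
    [IsProbabilityMeasure Pq] : IsProbabilityMeasure (jointLaw γ Pp Pq) := by
  unfold jointLaw; infer_instance

section

variable {ν : Measure E} {a b : E → ℝ} {θ : ℝ}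

lemma filt_mem (h : IsDensityPair ν a b) (hθ0 : 0 ≤ θ) (hθ1 : θ ≤ 1) (t : ℕ) (z : ℕ → E) :
    0 ≤ filt θ a b t z ∧ filt θ a b t z ≤ 1 := by
  induction t with
  | zero => simp [filt]
  | succ t ih =>
    obtain ⟨h0, h1⟩ := prior_mem hθ0 hθ1 (filt θ a b t z)
    simp only [filt, nextState, ih.2, if_true]
    exact bayes_mem h0 h1 (h.fst_nonneg _) (h.snd_nonneg _)

lemma prior_filt (h : IsDensityPair ν a b) (hθ0 : 0 ≤ θ) (hθ1 : θ ≤ 1) (t : ℕ) (z : ℕ → E) :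
    prior θ (filt θ a b t z) = filt θ a b t z + (1 - filt θ a b t z) * θ := by
  obtain ⟨h0, h1⟩ := filt_mem h hθ0 hθ1 t z
  rw [prior, min_eq_left h1, max_eq_right h0]

lemma measurable_filt (h : IsDensityPair ν a b) (t : ℕ) :
    Measurable[pathSigma E t] (filt θ a b t) := by
  induction t with
  | zero => exact measurable_const
  | succ t ih =>
    have h1 := ih.mono (pathSigma_mono (E := E) t.le_succ) le_rfl
    exact (measurable_nextState (θ := θ) h).comp
      (h1.prodMk (measurable_pathSigma_eval t.lt_succ_self))

lemma filt_update (h : IsDensityPair ν a b) (t : ℕ) (z : ℕ → E) (y : E) :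
    filt θ a b t (Function.update z t y) = filt θ a b t z :=
  apply_update_of_measurable (measurable_filt h t) z y

lemma filt_succ_update (h : IsDensityPair ν a b) (t : ℕ) (z : ℕ → E) (y : E) :
    filt θ a b (t + 1) (Function.update z t y) = nextState θ a b (filt θ a b t z) y := by
  simp only [filt, filt_update h, Function.update_self]

end

variable {Pp Pq : Measure E} [IsProbabilityMeasure Pp] [IsProbabilityMeasure Pq]

/-- One coordinate of a random path with independent coordinates may be resampled. -/
lemma infinitePi_map_update (κ : ℕ → Measure E) [∀ s, IsProbabilityMeasure (κ s)] (t : ℕ) :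
    ((Measure.infinitePi κ).prod (κ t)).map (fun p => Function.update p.1 t p.2)
      = Measure.infinitePi κ := by
  refine Measure.eq_infinitePi κ fun s B hB => ?_
  have hms (s : Finset ℕ) : MeasurableSet (Set.pi (s : Set ℕ) B) :=
    MeasurableSet.pi s.countable_toSet fun i _ => hB i
  rw [Measure.map_apply (measurable_update_path t) (hms s)]
  have hpre : (fun p : (ℕ → E) × E => Function.update p.1 t p.2) ⁻¹' (Set.pi (s : Set ℕ) B)
      = (Set.pi ((s.erase t : Finset ℕ) : Set ℕ) B) ×ˢ (if t ∈ s then B t else Set.univ) := by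
    ext p
    simp only [Set.mem_preimage, Set.mem_pi, Set.mem_prod, Finset.mem_coe, Finset.mem_erase]
    constructor
    · intro hp
      refine ⟨fun i hi => ?_, ?_⟩
      · simpa [Function.update_of_ne hi.1] using hp i hi.2
      · split_ifs with ht
        · simpa using hp t ht
        · trivial
    · rintro ⟨h1, h2⟩ i hi
      by_cases hit : i = t
      · subst hit; simpa [hi] using h2
      · simpa [Function.update_of_ne hit] using h1 i ⟨hit, hi⟩
  rw [hpre, Measure.prod_prod, Measure.infinitePi_pi _ fun i _ => hB i]
  by_cases ht : t ∈ s
  · rw [if_pos ht, Finset.prod_erase_mul _ _ ht]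
  · rw [if_neg ht, Finset.erase_eq_of_notMem ht, measure_univ, mul_one]

lemma lintegral_streamLaw_resample (m : ℕ∞) (t : ℕ) {φ : (ℕ → E) → ℝ≥0∞} (hφ : Measurable φ) :
    ∫⁻ z, φ z ∂(streamLaw Pp Pq m)
      = ∫⁻ z, ∫⁻ y, φ (Function.update z t y)
          ∂(if ((t + 1 : ℕ) : ℕ∞) ≤ m then Pp else Pq) ∂(streamLaw Pp Pq m) := by
  conv_lhs => rw [streamLaw, ← infinitePi_map_update _ t,
    lintegral_map hφ (measurable_update_path t)]
  exact lintegral_prod _ (hφ.comp (measurable_update_path t)).aemeasurable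

/-- Up to the change point, the observations do not depend on the change point. -/
lemma lintegral_streamLaw_of_le {t : ℕ} {m : ℕ∞} (hm : (t : ℕ∞) ≤ m) {φ : (ℕ → E) → ℝ≥0∞}
    (hφ : Measurable[pathSigma E t] φ) :
    ∫⁻ z, φ z ∂(streamLaw Pp Pq m) = ∫⁻ z, φ z ∂(streamLaw Pp Pq ⊤) := by
  obtain ⟨φ', hφ', rfl⟩ := hφ.exists_eq_measurable_comp
  have hmap (m : ℕ∞) (hm : (t : ℕ∞) ≤ m) :
      (streamLaw Pp Pq m).map (fun z (s : Fin t) => z s) = Measure.infinitePi fun _ : Fin t => Pp := by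
    rw [streamLaw, Measure.map_infinitePi_infinitePi_of_inj Fin.val_injective]
    congr 1
    ext1 s
    exact if_pos (le_trans (by exact_mod_cast s.2) hm)
  have hr : Measurable fun (z : ℕ → E) (s : Fin t) => z s := by fun_prop
  simp only [Function.comp_apply]
  rw [← lintegral_map hφ' hr, ← lintegral_map hφ' hr, hmap m hm, hmap ⊤ le_top]

variable {γ : Measure ℕ∞} {θ : ℝ}

lemma lintegral_jointLaw [SFinite γ] {F : ℕ∞ × (ℕ → E) → ℝ≥0∞} (hF : Measurable F) :
    ∫⁻ x, F x ∂(jointLaw γ Pp Pq) = ∫⁻ m, ∫⁻ z, F (m, z) ∂(streamLaw Pp Pq m) ∂γ := by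
  rw [jointLaw, Measure.lintegral_compProd hF]
  rfl

lemma lintegral_jointLaw_ite [SFinite γ] {p : ℕ∞ → Prop} [DecidablePred p]
    {φ : (ℕ → E) → ℝ≥0∞} (hφ : Measurable φ) :
    ∫⁻ x, (if p x.1 then φ x.2 else 0) ∂(jointLaw γ Pp Pq)
      = ∫⁻ m in {m | p m}, ∫⁻ z, φ z ∂(streamLaw Pp Pq m) ∂γ := by
  rw [lintegral_jointLaw, ← lintegral_indicator .of_discrete]
  · refine lintegral_congr fun m => ?_
    by_cases hm : p m <;> simp [hm]
  · exact Measurable.ite (measurable_fst (MeasurableSet.of_discrete (s := {m | p m})))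
      (hφ.comp measurable_snd) measurable_const

/-- On an event contained in `{τ ≥ t}` the first `t` observations are all pre-change, so their law
is the no-change law `streamLaw ⊤` and the integral factors. -/
lemma lintegral_jointLaw_ite_of_le [SFinite γ] {t : ℕ} {p : ℕ∞ → Prop} [DecidablePred p]
    (hp : ∀ m, p m → (t : ℕ∞) ≤ m) {φ : (ℕ → E) → ℝ≥0∞} (hφ : Measurable[pathSigma E t] φ) :
    ∫⁻ x, (if p x.1 then φ x.2 else 0) ∂(jointLaw γ Pp Pq)
      = γ {m | p m} * ∫⁻ z, φ z ∂(streamLaw Pp Pq ⊤) := by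
  rw [lintegral_jointLaw_ite (hφ.mono (pathSigma_le t) le_rfl),
    setLIntegral_congr_fun (s := {m | p m}) (g := fun _ => ∫⁻ z, φ z ∂(streamLaw Pp Pq ⊤))
      .of_discrete fun m hm => lintegral_streamLaw_of_le (hp m hm) hφ,
    setLIntegral_const, mul_comm]

/-- Coordinate `t` is the observation at time `t + 1`. On `τ < t + 1` it is post-change and
independent of the other coordinates, whatever the value of `τ`. -/
lemma lintegral_change_lt_resample [SFinite γ] (t : ℕ) {φ : (ℕ → E) → ℝ≥0∞} (hφ : Measurable φ) :
    ∫⁻ x, (if x.1 < ((t + 1 : ℕ) : ℕ∞) then φ x.2 else 0) ∂(jointLaw γ Pp Pq)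
      = ∫⁻ x, (if x.1 < ((t + 1 : ℕ) : ℕ∞) then ∫⁻ y, φ (Function.update x.2 t y) ∂Pq else 0)
          ∂(jointLaw γ Pp Pq) := by
  have hm : Measurable fun z => ∫⁻ y, φ (Function.update z t y) ∂Pq :=
    (hφ.comp (measurable_update_path t)).lintegral_prod_right'
  rw [lintegral_jointLaw_ite (p := fun m => m < ((t + 1 : ℕ) : ℕ∞)) hφ,
    lintegral_jointLaw_ite (p := fun m => m < ((t + 1 : ℕ) : ℕ∞)) hm]
  refine setLIntegral_congr_fun .of_discrete fun m hm => ?_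
  rw [lintegral_streamLaw_resample m t hφ, if_neg (not_le.2 hm)]

lemma lintegral_le_change_resample [SFinite γ] (t : ℕ) {φ : (ℕ → E) → ℝ≥0∞} (hφ : Measurable φ) :
    ∫⁻ x, (if ((t + 1 : ℕ) : ℕ∞) ≤ x.1 then φ x.2 else 0) ∂(jointLaw γ Pp Pq)
      = ∫⁻ x, (if ((t + 1 : ℕ) : ℕ∞) ≤ x.1 then ∫⁻ y, φ (Function.update x.2 t y) ∂Pp else 0)
          ∂(jointLaw γ Pp Pq) := by
  have hm : Measurable fun z => ∫⁻ y, φ (Function.update z t y) ∂Pp :=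
    (hφ.comp (measurable_update_path t)).lintegral_prod_right'
  rw [lintegral_jointLaw_ite (p := fun m => ((t + 1 : ℕ) : ℕ∞) ≤ m) hφ,
    lintegral_jointLaw_ite (p := fun m => ((t + 1 : ℕ) : ℕ∞) ≤ m) hm]
  refine setLIntegral_congr_fun .of_discrete fun m hm => ?_
  rw [lintegral_streamLaw_resample m t hφ]
  simp only [if_pos (show ((t + 1 : ℕ) : ℕ∞) ≤ m from hm)]

variable [IsProbabilityMeasure γ]

/-- Removing one atom at a time from total mass `1` yields the tail without summing a series, and
the possible atom at `∞` needs no separate treatment. -/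
lemma measure_le_of_geometric (hθ0 : 0 ≤ θ) (hθ1 : θ ≤ 1)
    (hγ : ∀ m : ℕ, γ {(m : ℕ∞)} = ENNReal.ofReal (θ * (1 - θ) ^ m)) (t : ℕ) :
    γ {m | (t : ℕ∞) ≤ m} = ENNReal.ofReal ((1 - θ) ^ t) := by
  have h1 : (0 : ℝ) ≤ 1 - θ := by linarith
  induction t with
  | zero => simp
  | succ t ih =>
    have hsplit : {m : ℕ∞ | (t : ℕ∞) ≤ m} = {(t : ℕ∞)} ∪ {m : ℕ∞ | ((t + 1 : ℕ) : ℕ∞) ≤ m} := by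
      ext m
      simp only [Set.mem_ofPred_eq, Set.mem_union, Set.mem_singleton_iff, Nat.cast_add,
        Nat.cast_one]
      rw [le_iff_eq_or_lt, ENat.add_one_le_iff (ENat.natCast_ne_top t), eq_comm]
    have hdisj : Disjoint {(t : ℕ∞)} {m : ℕ∞ | ((t + 1 : ℕ) : ℕ∞) ≤ m} := by
      rw [Set.disjoint_singleton_left, Set.mem_ofPred_eq, Nat.cast_le]
      omega
    rw [hsplit, measure_union hdisj .of_discrete, hγ] at ih
    have e : (1 - θ) ^ t = θ * (1 - θ) ^ t + (1 - θ) ^ (t + 1) := by ring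
    have e' := ENNReal.ofReal_add (p := θ * (1 - θ) ^ t) (q := (1 - θ) ^ (t + 1)) (by positivity)
      (by positivity)
    rw [← e] at e'
    exact (ENNReal.add_right_inj ENNReal.ofReal_ne_top).1 (ih.trans e')

/-- Memorylessness: the change has not occurred at time `t` either. -/
lemma lintegral_succ_le_change (hθ0 : 0 ≤ θ) (hθ1 : θ ≤ 1)
    (hγ : ∀ m : ℕ, γ {(m : ℕ∞)} = ENNReal.ofReal (θ * (1 - θ) ^ m)) {t : ℕ}
    {φ : (ℕ → E) → ℝ≥0∞} (hφ : Measurable[pathSigma E t] φ) :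
    ∫⁻ x, (if ((t + 1 : ℕ) : ℕ∞) ≤ x.1 then φ x.2 else 0) ∂(jointLaw γ Pp Pq)
      = ENNReal.ofReal (1 - θ)
        * ∫⁻ x, (if (t : ℕ∞) ≤ x.1 then φ x.2 else 0) ∂(jointLaw γ Pp Pq) := by
  rw [lintegral_jointLaw_ite_of_le (t := t) (fun m hm => le_trans (by simp) hm) hφ,
    lintegral_jointLaw_ite_of_le (t := t) (fun m hm => hm) hφ,
    measure_le_of_geometric hθ0 hθ1 hγ, measure_le_of_geometric hθ0 hθ1 hγ, ← mul_assoc,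
    ← ENNReal.ofReal_mul (by linarith), pow_succ, mul_comm (1 - θ)]

/-- Memorylessness: the hazard rate of the change point. -/
lemma lintegral_change_eq (hθ0 : 0 ≤ θ) (hθ1 : θ ≤ 1)
    (hγ : ∀ m : ℕ, γ {(m : ℕ∞)} = ENNReal.ofReal (θ * (1 - θ) ^ m)) {t : ℕ}
    {φ : (ℕ → E) → ℝ≥0∞} (hφ : Measurable[pathSigma E t] φ) :
    ∫⁻ x, (if x.1 = (t : ℕ∞) then φ x.2 else 0) ∂(jointLaw γ Pp Pq)
      = ENNReal.ofReal θ
        * ∫⁻ x, (if (t : ℕ∞) ≤ x.1 then φ x.2 else 0) ∂(jointLaw γ Pp Pq) := by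
  rw [lintegral_jointLaw_ite_of_le (t := t) (p := fun m => m = (t : ℕ∞)) (fun m hm => hm.ge) hφ,
    lintegral_jointLaw_ite_of_le (t := t) (p := fun m => (t : ℕ∞) ≤ m) (fun m hm => hm) hφ,
    measure_le_of_geometric hθ0 hθ1 hγ, Set.ofPred_eq_eq_singleton, hγ, ← mul_assoc,
    ← ENNReal.ofReal_mul hθ0]

end Stream

/-! ### The filter recursion computes the posterior probability. -/

section Posterior

variable {E : Type*} [MeasurableSpace E] {ν : Measure E} {a b : E → ℝ}
  {θ : ℝ} {Pp Pq : Measure E} {γ : Measure ℕ∞}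

/-- The data of a single stream of the i.i.d. model. -/
structure IsStream (ν : Measure E) (a b : E → ℝ) (θ : ℝ) (Pp Pq : Measure E)
    (γ : Measure ℕ∞) : Prop where
  density : IsDensityPair ν a b
  pre : Pp = ν.withDensity fun y => ENNReal.ofReal (a y)
  post : Pq = ν.withDensity fun y => ENNReal.ofReal (b y)
  nonneg : 0 ≤ θ
  le_one : θ ≤ 1
  geometric : ∀ m : ℕ, γ {(m : ℕ∞)} = ENNReal.ofReal (θ * (1 - θ) ^ m)

lemma IsStream.lintegral_pre (h : IsStream ν a b θ Pp Pq γ) {g : E → ℝ≥0∞} (hg : Measurable g) :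
    ∫⁻ y, g y ∂Pp = ∫⁻ y, g y * ENNReal.ofReal (a y) ∂ν := by
  have ha := h.density.measurable_fst
  rw [h.pre, lintegral_withDensity_eq_lintegral_mul _ (by fun_prop) hg]
  simp [mul_comm]

lemma IsStream.lintegral_post (h : IsStream ν a b θ Pp Pq γ) {g : E → ℝ≥0∞} (hg : Measurable g) :
    ∫⁻ y, g y ∂Pq = ∫⁻ y, g y * ENNReal.ofReal (b y) ∂ν := by
  have hb := h.density.measurable_snd
  rw [h.post, lintegral_withDensity_eq_lintegral_mul _ (by fun_prop) hg]
  simp [mul_comm]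

lemma lintegral_change_lt_add {t : ℕ} {φ : (ℕ → E) → ℝ≥0∞} (hφ : Measurable φ) :
    ∫⁻ x, φ x.2 ∂(jointLaw γ Pp Pq)
      = ∫⁻ x, (if x.1 < (t : ℕ∞) then φ x.2 else 0) ∂(jointLaw γ Pp Pq)
        + ∫⁻ x, (if (t : ℕ∞) ≤ x.1 then φ x.2 else 0) ∂(jointLaw γ Pp Pq) := by
  rw [← lintegral_add_left]
  · refine lintegral_congr fun x => ?_
    rcases lt_or_ge x.1 (t : ℕ∞) with h | h
    · rw [if_pos h, if_neg (not_le.2 h), add_zero]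
    · rw [if_neg (not_lt.2 h), if_pos h, zero_add]
  · exact Measurable.ite (measurable_fst (MeasurableSet.of_discrete (s := {m | m < (t : ℕ∞)})))
      (hφ.comp measurable_snd) measurable_const

lemma lintegral_change_lt_succ {t : ℕ} {φ : (ℕ → E) → ℝ≥0∞} (hφ : Measurable φ) :
    ∫⁻ x, (if x.1 < ((t + 1 : ℕ) : ℕ∞) then φ x.2 else 0) ∂(jointLaw γ Pp Pq)
      = ∫⁻ x, (if x.1 < (t : ℕ∞) then φ x.2 else 0) ∂(jointLaw γ Pp Pq)
        + ∫⁻ x, (if x.1 = (t : ℕ∞) then φ x.2 else 0) ∂(jointLaw γ Pp Pq) := by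
  rw [← lintegral_add_left]
  · refine lintegral_congr fun x => ?_
    have : x.1 < ((t + 1 : ℕ) : ℕ∞) ↔ x.1 < (t : ℕ∞) ∨ x.1 = (t : ℕ∞) := by
      rw [← le_iff_lt_or_eq, Nat.cast_add, Nat.cast_one,
        ENat.lt_add_one_iff (ENat.natCast_ne_top t)]
    rcases lt_trichotomy x.1 (t : ℕ∞) with h | h | h
    · rw [if_pos (this.2 (Or.inl h)), if_pos h, if_neg h.ne, add_zero]
    · rw [if_pos (this.2 (Or.inr h)), if_neg h.not_lt, if_pos h, zero_add]
    · rw [if_neg (fun h' => (this.1 h').elim h.not_gt h.ne'), if_neg h.not_gt, if_neg h.ne',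
        add_zero]
  · exact Measurable.ite (measurable_fst (MeasurableSet.of_discrete (s := {m | m < (t : ℕ∞)})))
      (hφ.comp measurable_snd) measurable_const

variable [IsProbabilityMeasure Pp] [IsProbabilityMeasure Pq] [IsProbabilityMeasure γ]

/-- The statement that `filt t` is the posterior probability of a change before time `t`. -/
def IsPosterior (θ : ℝ) (a b : E → ℝ) (Pp Pq : Measure E) (γ : Measure ℕ∞) (t : ℕ) : Prop :=
  ∀ φ : (ℕ → E) → ℝ≥0∞, Measurable[pathSigma E t] φ →
    ∫⁻ x, (if x.1 < (t : ℕ∞) then φ x.2 else 0) ∂(jointLaw γ Pp Pq)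
        = ∫⁻ x, ENNReal.ofReal (filt θ a b t x.2) * φ x.2 ∂(jointLaw γ Pp Pq) ∧
    ∫⁻ x, (if (t : ℕ∞) ≤ x.1 then φ x.2 else 0) ∂(jointLaw γ Pp Pq)
        = ∫⁻ x, ENNReal.ofReal (1 - filt θ a b t x.2) * φ x.2 ∂(jointLaw γ Pp Pq)

lemma IsStream.lintegral_succ_le (h : IsStream ν a b θ Pp Pq γ) {t : ℕ}
    (ht : IsPosterior θ a b Pp Pq γ t) {φ : (ℕ → E) → ℝ≥0∞} (hφ : Measurable[pathSigma E t] φ) :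
    ∫⁻ x, (if ((t + 1 : ℕ) : ℕ∞) ≤ x.1 then φ x.2 else 0) ∂(jointLaw γ Pp Pq)
      = ∫⁻ x, ENNReal.ofReal (1 - prior θ (filt θ a b t x.2)) * φ x.2 ∂(jointLaw γ Pp Pq) := by
  have hm : Measurable (filt θ a b t) := (measurable_filt h.density t).mono (pathSigma_le t) le_rfl
  have hφ' : Measurable φ := hφ.mono (pathSigma_le t) le_rfl
  rw [lintegral_succ_le_change h.nonneg h.le_one h.geometric hφ, (ht φ hφ).2,
    ← lintegral_const_mul _ (by fun_prop)]
  refine lintegral_congr fun x => ?_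
  rw [← mul_assoc, ← ENNReal.ofReal_mul (by linarith [h.le_one]),
    prior_filt h.density h.nonneg h.le_one]
  congr 2
  ring

/-- Split `{τ < t + 1}` into `{τ < t}`, of posterior mass `w`, and `{τ = t}`, of mass `θ (1 - w)` by
the constant hazard rate. -/
lemma IsStream.lintegral_lt_succ (h : IsStream ν a b θ Pp Pq γ) {t : ℕ}
    (ht : IsPosterior θ a b Pp Pq γ t) {φ : (ℕ → E) → ℝ≥0∞} (hφ : Measurable[pathSigma E t] φ) :
    ∫⁻ x, (if x.1 < ((t + 1 : ℕ) : ℕ∞) then φ x.2 else 0) ∂(jointLaw γ Pp Pq)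
      = ∫⁻ x, ENNReal.ofReal (prior θ (filt θ a b t x.2)) * φ x.2 ∂(jointLaw γ Pp Pq) := by
  have hm : Measurable (filt θ a b t) := (measurable_filt h.density t).mono (pathSigma_le t) le_rfl
  have hφ' : Measurable φ := hφ.mono (pathSigma_le t) le_rfl
  rw [lintegral_change_lt_succ hφ', lintegral_change_eq h.nonneg h.le_one h.geometric hφ,
    (ht φ hφ).1, (ht φ hφ).2, ← lintegral_const_mul _ (by fun_prop),
    ← lintegral_add_left (by fun_prop)]
  refine lintegral_congr fun x => ?_
  obtain ⟨h0, h1⟩ := filt_mem h.density h.nonneg h.le_one t x.2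
  rw [← mul_assoc, ← ENNReal.ofReal_mul h.nonneg, ← add_mul,
    ← ENNReal.ofReal_add h0 (mul_nonneg h.nonneg (by linarith)),
    prior_filt h.density h.nonneg h.le_one]
  congr 2
  ring

variable [IsProbabilityMeasure ν]

/-- Draw the last observation afresh from the post-change law; what is left depends on the first `t`
observations only, where `prior` gives the weight of the event. -/
lemma IsStream.lintegral_lt_succ_resample (h : IsStream ν a b θ Pp Pq γ) {t : ℕ}
    (ht : IsPosterior θ a b Pp Pq γ t) {φ : (ℕ → E) → ℝ≥0∞}
    (hφ : Measurable[pathSigma E (t + 1)] φ) :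
    ∫⁻ x, (if x.1 < ((t + 1 : ℕ) : ℕ∞) then φ x.2 else 0) ∂(jointLaw γ Pp Pq)
      = ∫⁻ x, ∫⁻ y, φ (Function.update x.2 t y)
          * ENNReal.ofReal (prior θ (filt θ a b t x.2) * b y) ∂ν ∂(jointLaw γ Pp Pq) := by
  have hb := h.density.measurable_snd
  have hφ' : Measurable φ := hφ.mono (pathSigma_le _) le_rfl
  have hu (z : ℕ → E) : Measurable fun y => φ (Function.update z t y) :=
    (hφ'.comp (measurable_update_path t)).comp measurable_prodMk_left
  have hmul (z : ℕ → E) : Measurable fun y => φ (Function.update z t y) * ENNReal.ofReal (b y) :=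
    (hu z).mul (by fun_prop)
  rw [lintegral_change_lt_resample t hφ']
  simp only [h.lintegral_post (hu _)]
  rw [h.lintegral_lt_succ ht (measurable_lintegral_update hφ ν (by fun_prop))]
  refine lintegral_congr fun x => ?_
  rw [← lintegral_const_mul _ (hmul x.2)]
  refine lintegral_congr fun y => ?_
  rw [ENNReal.ofReal_mul (prior_mem h.nonneg h.le_one _).1]
  ring

lemma IsStream.lintegral_succ_le_resample (h : IsStream ν a b θ Pp Pq γ) {t : ℕ}
    (ht : IsPosterior θ a b Pp Pq γ t) {φ : (ℕ → E) → ℝ≥0∞}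
    (hφ : Measurable[pathSigma E (t + 1)] φ) :
    ∫⁻ x, (if ((t + 1 : ℕ) : ℕ∞) ≤ x.1 then φ x.2 else 0) ∂(jointLaw γ Pp Pq)
      = ∫⁻ x, ∫⁻ y, φ (Function.update x.2 t y)
          * ENNReal.ofReal ((1 - prior θ (filt θ a b t x.2)) * a y) ∂ν ∂(jointLaw γ Pp Pq) := by
  have ha := h.density.measurable_fst
  have hφ' : Measurable φ := hφ.mono (pathSigma_le _) le_rfl
  have hu (z : ℕ → E) : Measurable fun y => φ (Function.update z t y) :=
    (hφ'.comp (measurable_update_path t)).comp measurable_prodMk_left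
  have hmul (z : ℕ → E) : Measurable fun y => φ (Function.update z t y) * ENNReal.ofReal (a y) :=
    (hu z).mul (by fun_prop)
  rw [lintegral_le_change_resample t hφ']
  simp only [h.lintegral_pre (hu _)]
  rw [h.lintegral_succ_le ht (measurable_lintegral_update hφ ν (by fun_prop))]
  refine lintegral_congr fun x => ?_
  rw [← lintegral_const_mul _ (hmul x.2)]
  refine lintegral_congr fun y => ?_
  rw [ENNReal.ofReal_mul (by linarith [(prior_mem h.nonneg h.le_one (filt θ a b t x.2)).2])]
  ring

/-- The predictive law of the next observation of a stream. -/
lemma IsStream.lintegral_resample_of_isPosterior (h : IsStream ν a b θ Pp Pq γ) {t : ℕ}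
    (ht : IsPosterior θ a b Pp Pq γ t) {φ : (ℕ → E) → ℝ≥0∞}
    (hφ : Measurable[pathSigma E (t + 1)] φ) :
    ∫⁻ x, φ x.2 ∂(jointLaw γ Pp Pq)
      = ∫⁻ x, ∫⁻ y, φ (Function.update x.2 t y) * predDensity θ a b (filt θ a b t x.2) y ∂ν
          ∂(jointLaw γ Pp Pq) := by
  have ha := h.density.measurable_fst
  have hb := h.density.measurable_snd
  have hφ' : Measurable φ := hφ.mono (pathSigma_le _) le_rfl
  have hm : Measurable (filt θ a b t) := (measurable_filt h.density t).mono (pathSigma_le t) le_rfl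
  have hp := measurable_prior θ
  have hu : Measurable fun p : (ℕ∞ × (ℕ → E)) × E => φ (Function.update p.1.2 t p.2)
      * ENNReal.ofReal (prior θ (filt θ a b t p.1.2) * b p.2) :=
    (hφ'.comp ((measurable_update_path t).comp (by fun_prop :
      Measurable fun p : (ℕ∞ × (ℕ → E)) × E => (p.1.2, p.2)))).mul (by fun_prop)
  rw [lintegral_change_lt_add (t := t + 1) hφ', h.lintegral_lt_succ_resample ht hφ,
    h.lintegral_succ_le_resample ht hφ, ← lintegral_add_left hu.lintegral_prod_right']
  refine lintegral_congr fun x => ?_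
  have hux : Measurable fun y => φ (Function.update x.2 t y)
      * ENNReal.ofReal (prior θ (filt θ a b t x.2) * b y) := hu.comp measurable_prodMk_left
  refine (lintegral_add_left hux _).symm.trans ?_
  refine lintegral_congr fun y => ?_
  obtain ⟨h0, h1⟩ := prior_mem h.nonneg h.le_one (filt θ a b t x.2)
  rw [← mul_add, ← ENNReal.ofReal_add (mul_nonneg h0 (h.density.snd_nonneg y))
    (mul_nonneg (by linarith) (h.density.fst_nonneg y)), predDensity]

/-- Also true when the denominator vanishes, since both of its nonnegative summands are then zero.
No null set has to be removed. -/
lemma bayes_mul {v r s : ℝ} (hv0 : 0 ≤ v) (hv1 : v ≤ 1) (hr : 0 ≤ r) (hs : 0 ≤ s) :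
    bayes v r s * (v * s + (1 - v) * r) = v * s := by
  have h1 : 0 ≤ v * s := mul_nonneg hv0 hs
  have h2 : 0 ≤ (1 - v) * r := mul_nonneg (by linarith) hr
  rcases eq_or_ne (v * s + (1 - v) * r) 0 with h0 | h0
  · rw [h0, mul_zero]; linarith
  · rw [bayes, div_mul_cancel₀ _ h0]

lemma ofReal_bayes_mul {v r s : ℝ} (hv0 : 0 ≤ v) (hv1 : v ≤ 1) (hr : 0 ≤ r) (hs : 0 ≤ s) :
    ENNReal.ofReal (bayes v r s) * ENNReal.ofReal (v * s + (1 - v) * r)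
      = ENNReal.ofReal (v * s) := by
  rw [← ENNReal.ofReal_mul (bayes_mem hv0 hv1 hr hs).1, bayes_mul hv0 hv1 hr hs]

lemma ofReal_one_sub_bayes_mul {v r s : ℝ} (hv0 : 0 ≤ v) (hv1 : v ≤ 1) (hr : 0 ≤ r)
    (hs : 0 ≤ s) :
    ENNReal.ofReal (1 - bayes v r s) * ENNReal.ofReal (v * s + (1 - v) * r)
      = ENNReal.ofReal ((1 - v) * r) := by
  rw [← ENNReal.ofReal_mul (by linarith [(bayes_mem hv0 hv1 hr hs).2]),
    sub_mul, bayes_mul hv0 hv1 hr hs]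
  congr 1
  ring

/-- The filter recursion computes the posterior probabilities. -/
lemma IsStream.isPosterior (h : IsStream ν a b θ Pp Pq γ) (t : ℕ) :
    IsPosterior θ a b Pp Pq γ t := by
  induction t with
  | zero =>
    intro φ _
    simp [filt]
  | succ t ih =>
    intro φ hφ
    have hm := measurable_filt (θ := θ) h.density (t + 1)
    have hmem (x : ℕ∞ × (ℕ → E)) := prior_mem h.nonneg h.le_one (filt θ a b t x.2)
    have hnext (x : ℕ∞ × (ℕ → E)) (y : E) : nextState θ a b (filt θ a b t x.2) y
        = bayes (prior θ (filt θ a b t x.2)) (a y) (b y) :=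
      if_pos (filt_mem h.density h.nonneg h.le_one t x.2).2
    constructor
    -- Both sides are written as integrals over a fresh observation `y`. Pointwise, posterior times
    -- predictive density equals prior times post-change density.
    · rw [h.lintegral_lt_succ_resample ih hφ, h.lintegral_resample_of_isPosterior ih
        (φ := fun z => ENNReal.ofReal (filt θ a b (t + 1) z) * φ z)
        ((ENNReal.measurable_ofReal.comp hm).mul hφ)]
      refine lintegral_congr fun x => lintegral_congr fun y => ?_
      simp only [filt_succ_update h.density, hnext, predDensity]
      rw [← ofReal_bayes_mul (hmem x).1 (hmem x).2 (h.density.fst_nonneg y)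
        (h.density.snd_nonneg y)]
      ring
    · rw [h.lintegral_succ_le_resample ih hφ, h.lintegral_resample_of_isPosterior ih
        (φ := fun z => ENNReal.ofReal (1 - filt θ a b (t + 1) z) * φ z)
        ((ENNReal.measurable_ofReal.comp (measurable_const.sub hm)).mul hφ)]
      refine lintegral_congr fun x => lintegral_congr fun y => ?_
      simp only [filt_succ_update h.density, hnext, predDensity]
      rw [← ofReal_one_sub_bayes_mul (hmem x).1 (hmem x).2 (h.density.fst_nonneg y)
        (h.density.snd_nonneg y)]
      ring

end Posterior

/-! ### Passage from one stream to independent parallel streams. -/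

section Parallel

variable {E : Type*} [MeasurableSpace E] {K : ℕ}

/-- The σ-algebra of the first `t` coordinates of all streams. -/
@[reducible] def historySigma (K : ℕ) (E : Type*) [MeasurableSpace E] (t : ℕ) :
    MeasurableSpace (Fin K → ℕ → E) :=
  MeasurableSpace.comap (fun z k (s : Fin t) => z k s) MeasurableSpace.pi

lemma historySigma_le (t : ℕ) : historySigma K E t ≤ MeasurableSpace.pi := by
  rw [← measurable_iff_comap_le]
  fun_prop

lemma measurable_pathSigma_update {t : ℕ} {φ : (Fin K → ℕ → E) → ℝ≥0∞}
    (hφ : Measurable[historySigma K E t] φ) (w : Fin K → ℕ → E) (k : Fin K) :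
    Measurable[pathSigma E t] fun z => φ (Function.update w k z) := by
  obtain ⟨φ', hφ', rfl⟩ := hφ.exists_eq_measurable_comp
  have h1 : Measurable fun u : Fin t → E =>
      φ' (Function.update (fun k (s : Fin t) => w k s) k u) := hφ'.comp (measurable_update _)
  convert h1.comp (comap_measurable fun (z : ℕ → E) (s : Fin t) => z s) using 1
  ext z
  simp only [Function.comp_apply]
  congr 1
  ext j s
  by_cases hj : j = k
  · subst hj; simp
  · simp [hj]

/-- Identities for one stream, conditionally on its history, carry over to parallel streams. -/
lemma lintegral_pi_mul_congr {ρ : Fin K → Measure (ℕ∞ × (ℕ → E))}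
    [∀ k, IsProbabilityMeasure (ρ k)] {t : ℕ} (k : Fin K) {c c' : ℕ∞ × (ℕ → E) → ℝ≥0∞}
    (hc : Measurable c) (hc' : Measurable c')
    (h : ∀ ψ : (ℕ → E) → ℝ≥0∞, Measurable[pathSigma E t] ψ →
      ∫⁻ x, c x * ψ x.2 ∂(ρ k) = ∫⁻ x, c' x * ψ x.2 ∂(ρ k))
    {φ : (Fin K → ℕ → E) → ℝ≥0∞} (hφ : Measurable[historySigma K E t] φ) :
    ∫⁻ x, c (x k) * φ (fun j => (x j).2) ∂(Measure.pi ρ)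
      = ∫⁻ x, c' (x k) * φ (fun j => (x j).2) ∂(Measure.pi ρ) := by
  have hφ' : Measurable φ := hφ.mono (historySigma_le t) le_rfl
  refine lintegral_eq_of_lmarginal_eq {k} (by fun_prop) (by fun_prop) ?_
  ext y
  have e (r : ℕ∞ × (ℕ → E)) : (fun j => (Function.update y k r j).2)
      = Function.update (fun j => (y j).2) k r.2 := by
    ext1 j
    by_cases hj : j = k
    · subst hj; simp
    · simp [hj]
  simp only [lmarginal_singleton, Function.update_self, e]
  exact h _ (measurable_pathSigma_update hφ _ k)

/-- On boxes the indicator factors over the coordinates. This merges the one-stream predictive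
densities into the product appearing in `transition`. -/
lemma pi_withDensity {α : Type*} [MeasurableSpace α] (ρ : Fin K → Measure α)
    [∀ k, IsProbabilityMeasure (ρ k)] {d : α → ℝ≥0∞} (hd : Measurable d)
    [∀ k, SigmaFinite ((ρ k).withDensity d)] :
    Measure.pi (fun k => (ρ k).withDensity d)
      = (Measure.pi ρ).withDensity fun x => ∏ k, d (x k) := by
  refine Measure.pi_eq fun s hs => ?_
  rw [withDensity_apply _ (MeasurableSet.univ_pi hs),
    ← lintegral_indicator (MeasurableSet.univ_pi hs)]
  calc ∫⁻ x, (Set.univ.pi s).indicator (fun x => ∏ k, d (x k)) x ∂(Measure.pi ρ)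
      = ∫⁻ x, ∏ k, (s k).indicator d (x k) ∂(Measure.pi ρ) := by
        refine lintegral_congr fun x => ?_
        by_cases hx : x ∈ Set.univ.pi s
        · rw [Set.indicator_of_mem hx]
          refine Finset.prod_congr rfl fun k _ => ?_
          rw [Set.indicator_of_mem (hx k trivial)]
        · rw [Set.indicator_of_notMem hx]
          simp only [Set.mem_pi, Set.mem_univ, true_imp_iff, not_forall] at hx
          obtain ⟨k, hk⟩ := hx
          exact (Finset.prod_eq_zero (Finset.mem_univ k) (Set.indicator_of_notMem hk _)).symm
    _ = ∏ k, ∫⁻ x, (s k).indicator d x ∂(ρ k) :=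
        lintegral_pi_prod (fun k => hd.indicator (hs k)) ρ
    _ = ∏ k, (ρ k).withDensity d (s k) := by
        refine Finset.prod_congr rfl fun k _ => ?_
        rw [lintegral_indicator (hs k), withDensity_apply _ (hs k)]

variable {ν : Measure E} [IsProbabilityMeasure ν] {a b : E → ℝ} {θ : ℝ} {Pp Pq : Measure E}
  [IsProbabilityMeasure Pp] [IsProbabilityMeasure Pq] {γ : Fin K → Measure ℕ∞}
  [∀ k, IsProbabilityMeasure (γ k)]

/-- The predictive law of the next observations of all streams. -/
lemma lintegral_pi_resample (h : ∀ k, IsStream ν a b θ Pp Pq (γ k)) (hd : IsDensityPair ν a b)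
    (hθ0 : 0 ≤ θ) (hθ1 : θ ≤ 1) (t : ℕ)
    {φ : (Fin K → ℕ → E) → ℝ≥0∞} (hφ : Measurable[historySigma K E (t + 1)] φ) :
    ∫⁻ x, φ (fun k => (x k).2) ∂(Measure.pi fun k => jointLaw (γ k) Pp Pq)
      = ∫⁻ x, ∫⁻ y, φ (fun k => Function.update (x k).2 t (y k))
          * ∏ k, predDensity θ a b (filt θ a b t (x k).2) (y k)
          ∂(Measure.pi fun _ => ν) ∂(Measure.pi fun k => jointLaw (γ k) Pp Pq) := by
  set ρ := fun k => jointLaw (γ k) Pp Pq with hρ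
  have hφ' : Measurable φ := hφ.mono (historySigma_le _) le_rfl
  have hmf : Measurable (filt θ a b t) := (measurable_filt hd t).mono (pathSigma_le t) le_rfl
  let d : (ℕ∞ × (ℕ → E)) × E → ℝ≥0∞ := fun p => predDensity θ a b (filt θ a b t p.1.2) p.2
  have hdm : Measurable d := (measurable_predDensity (θ := θ) hd).comp
    (f := fun p : (ℕ∞ × (ℕ → E)) × E => (filt θ a b t p.1.2, p.2)) (by fun_prop)
  -- Under `N k` a stream is paired with a fresh observation drawn from its predictive density.
  let N : Fin K → Measure ((ℕ∞ × (ℕ → E)) × E) := fun k => ((ρ k).prod ν).withDensity d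
  have hN (k : Fin K) : IsProbabilityMeasure (N k) := by
    refine ⟨?_⟩
    rw [withDensity_apply _ .univ, setLIntegral_univ, lintegral_prod _ hdm.aemeasurable]
    simp only [d, lintegral_predDensity hd hθ0 hθ1]
    simp
  let r : (ℕ → E) → (Fin (t + 1) → E) := fun z s => z s
  have hr : Measurable r := by fun_prop
  let u : (ℕ∞ × (ℕ → E)) × E → (ℕ → E) := fun p => Function.update p.1.2 t p.2
  have hu : Measurable u := (measurable_update_path t).comp
    (f := fun p : (ℕ∞ × (ℕ → E)) × E => (p.1.2, p.2)) (by fun_prop)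
  -- Only the first `t + 1` coordinates are compared: later observations stay tied to the change
  -- point, which the fresh observation ignores.
  have hlaw (k : Fin K) : (ρ k).map (fun x => r x.2) = (N k).map (fun p => r (u p)) := by
    ext B hB
    have hB' : Measurable[pathSigma E (t + 1)] (fun z => B.indicator (1 : (Fin (t + 1) → E) → ℝ≥0∞) (r z)) :=
      (measurable_one.indicator hB).comp (comap_measurable _)
    have h1 := (h k).lintegral_resample_of_isPosterior ((h k).isPosterior t) hB'
    rw [← lintegral_indicator_one hB, ← lintegral_indicator_one hB,
      lintegral_map (measurable_one.indicator hB) (by fun_prop),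
      lintegral_map (measurable_one.indicator hB) (by fun_prop)]
    refine h1.trans ?_
    have h2 : Measurable fun p => B.indicator (1 : (Fin (t + 1) → E) → ℝ≥0∞) (r (u p)) :=
      (measurable_one.indicator hB).comp (hr.comp hu)
    rw [lintegral_withDensity_eq_lintegral_mul _ hdm h2,
      lintegral_prod _ (hdm.mul h2).aemeasurable]
    refine lintegral_congr fun x => lintegral_congr fun y => ?_
    exact mul_comm _ _
  obtain ⟨φ', hφm, rfl⟩ := hφ.exists_eq_measurable_comp
  have e1 : ∫⁻ x, φ' (fun k => r (x k).2) ∂(Measure.pi ρ)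
      = ∫⁻ p, φ' (fun k => r (u (p k))) ∂(Measure.pi N) := by
    rw [← lintegral_map (f := φ') (g := fun (x : Fin K → ℕ∞ × (ℕ → E)) k => r (x k).2) hφm
        (by fun_prop),
      ← lintegral_map (f := φ') (g := fun (p : Fin K → (ℕ∞ × (ℕ → E)) × E) k => r (u (p k))) hφm
        (by fun_prop)]
    have h1 := Measure.pi_map_pi (μ := ρ) (f := fun _ x => r x.2) (fun k => by fun_prop)
    have h2 := Measure.pi_map_pi (μ := N) (f := fun _ p => r (u p)) (fun k => by fun_prop)
    rw [h1, h2]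
    simp only [hlaw]
  refine e1.trans ?_
  have hprod : Measurable fun p : Fin K → (ℕ∞ × (ℕ → E)) × E => ∏ k, d (p k) :=
    Finset.measurable_prod _ fun k _ => hdm.comp (measurable_pi_apply k)
  have hφu : Measurable fun p : Fin K → (ℕ∞ × (ℕ → E)) × E => φ' fun k => r (u (p k)) :=
    hφm.comp (by fun_prop)
  rw [pi_withDensity (fun k => (ρ k).prod ν) hdm,
    lintegral_withDensity_eq_lintegral_mul _ hprod hφu]
  -- A family of pairs is regrouped as a pair of families, so that records and fresh observations
  -- are integrated separately.
  have hmp := measurePreserving_arrowProdEquivProdArrow (ℕ∞ × (ℕ → E)) E (Fin K) ρ (fun _ => ν)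
  have e2 := hmp.symm.lintegral_comp (hprod.mul hφu)
  rw [← e2, lintegral_prod]
  · refine lintegral_congr fun x => lintegral_congr fun y => ?_
    exact mul_comm _ _
  · exact ((hprod.mul hφu).comp (MeasurableEquiv.measurable _)).aemeasurable

end Parallel

/-! ### From the change-point model to a product law of records. -/

section Observation

variable {Ω E : Type*} [MeasurableSpace Ω] [MeasurableSpace E] {K : ℕ}

/-- The baseline measure is arbitrary and the given densities may be infinite. The average of the
two laws is a dominating probability measure, with a.e. finite Radon–Nikodym derivatives, so
real-valued densities exist. -/
lemma exists_density_pair (Pp Pq : Measure E) [IsProbabilityMeasure Pp]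
    [IsProbabilityMeasure Pq] :
    ∃ (ν : Measure E) (a b : E → ℝ), IsProbabilityMeasure ν ∧ IsDensityPair ν a b ∧
      Pp = ν.withDensity (fun y => ENNReal.ofReal (a y)) ∧
      Pq = ν.withDensity (fun y => ENNReal.ofReal (b y)) := by
  let ν : Measure E := (2⁻¹ : ℝ≥0∞) • (Pp + Pq)
  have hν : IsProbabilityMeasure ν := by
    refine ⟨?_⟩
    simp only [ν, Measure.smul_apply, Measure.add_apply, measure_univ, smul_eq_mul]
    rw [one_add_one_eq_two]
    exact ENNReal.inv_mul_cancel two_ne_zero ENNReal.ofNat_ne_top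
  have h2 : (2⁻¹ : ℝ≥0∞) ≠ 0 := ENNReal.inv_ne_zero.2 ENNReal.ofNat_ne_top
  have hdens (R : Measure E) [IsProbabilityMeasure R] (hR : R ≪ Pp + Pq) :
      R = ν.withDensity fun y => ENNReal.ofReal (R.rnDeriv ν y).toReal := by
    have hRν : R ≪ ν := by
      intro s hs
      refine hR ?_
      simpa [ν, h2] using hs
    conv_lhs => rw [← Measure.withDensity_rnDeriv_eq R ν hRν]
    refine withDensity_congr_ae ?_
    filter_upwards [Measure.rnDeriv_lt_top R ν] with y hy
    rw [ENNReal.ofReal_toReal hy.ne]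
  have hp := hdens Pp (Measure.le_add_right le_rfl).absolutelyContinuous
  have hq := hdens Pq (Measure.le_add_left le_rfl).absolutelyContinuous
  have hone (R : Measure E) [IsProbabilityMeasure R] (c : E → ℝ≥0∞) (h : R = ν.withDensity c) :
      ∫⁻ y, c y ∂ν = 1 := by
    rw [← setLIntegral_univ, ← withDensity_apply _ .univ, ← h, measure_univ]
  exact ⟨ν, _, _, hν, ⟨(Measure.measurable_rnDeriv _ _).ennreal_toReal,
    (Measure.measurable_rnDeriv _ _).ennreal_toReal, fun _ => ENNReal.toReal_nonneg,
    fun _ => ENNReal.toReal_nonneg, hone Pp _ hp, hone Pq _ hq⟩, hp, hq⟩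

/-- The observed paths of all streams. -/
def path (X : Fin K → ℕ → Ω → E) (ω : Ω) : Fin K → ℕ → E := fun k s => X k (s + 1) ω

/-- The change points together with the observed paths. -/
def record (τ : Fin K → Ω → ℕ∞) (X : Fin K → ℕ → Ω → E) (ω : Ω) : Fin K → ℕ∞ × (ℕ → E) :=
  fun k => (τ k ω, path X ω k)

variable {P : Measure Ω} {μ : Measure E} {p q : E → ℝ≥0∞} {θ : ℝ}
  {τ : Fin K → Ω → ℕ∞} {X : Fin K → ℕ → Ω → E}

lemma IsIIDModel.measurable_path (h : IsIIDModel P μ p q θ τ X) : Measurable (path X) :=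
  measurable_pi_lambda _ fun k => measurable_pi_lambda _ fun s =>
    h.model.measurable_X k (s + 1) (Nat.le_add_left 1 s)

lemma IsIIDModel.measurable_record (h : IsIIDModel P μ p q θ τ X) : Measurable (record τ X) :=
  measurable_pi_lambda _ fun k => (h.model.measurable_tau k).prodMk
    ((measurable_pi_apply k).comp h.measurable_path)

variable [IsProbabilityMeasure P]

/-- Independence over all pairs of stream and time gives an infinite product over `Fin K × ℕ`;
currying groups it into one infinite product per stream. -/
lemma IsIIDModel.cond_map_path (h : IsIIDModel P μ p q θ τ X)
    [IsProbabilityMeasure (μ.withDensity p)] [IsProbabilityMeasure (μ.withDensity q)]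
    (m : Fin K → ℕ∞) (hm : P {ω | ∀ k, τ k ω = m k} ≠ 0) :
    (cond P {ω | ∀ k, τ k ω = m k}).map (path X)
      = Measure.pi fun k => streamLaw (μ.withDensity p) (μ.withDensity q) (m k) := by
  set Pm := cond P {ω | ∀ k, τ k ω = m k} with hPm
  have hX (i : Fin K × ℕ) : Measurable (X i.1 (i.2 + 1)) :=
    h.model.measurable_X i.1 (i.2 + 1) (Nat.le_add_left 1 i.2)
  have : IsProbabilityMeasure Pm := cond_isProbabilityMeasure hm
  let κ : Fin K → ℕ → Measure E := fun k s =>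
    if ((s + 1 : ℕ) : ℕ∞) ≤ m k then μ.withDensity p else μ.withDensity q
  have hκ : ∀ i : Fin K × ℕ, Pm.map (X i.1 (i.2 + 1)) = κ i.1 i.2 := by
    intro i
    rw [hPm, h.model.condLaw m hm i.1 (i.2 + 1) (Nat.le_add_left 1 i.2)]
    simp only [κ]
    split_ifs <;> rfl
  have hκp (k : Fin K) (s : ℕ) : IsProbabilityMeasure (κ k s) := by
    simp only [κ]; infer_instance
  have h1 := (h.model.condIndep m hm).map_fun_eq_infinitePi_map hX
  have h2 : Pm.map (fun ω (i : Fin K × ℕ) => X i.1 (i.2 + 1) ω)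
      = Measure.infinitePi fun i : Fin K × ℕ => κ i.1 i.2 := by
    rw [h1]
    congr 1
    ext1 i
    exact hκ i
  have h3 := Measure.infinitePi_map_curry κ
  rw [← h2, Measure.map_map (by fun_prop) (measurable_pi_lambda _ hX)] at h3
  rw [← Measure.infinitePi_eq_pi]
  exact h3

/-- Change points take countably many values, so it suffices to test on sets that fix the change
point, which is where the conditional assumptions of the model speak. -/
lemma generateFrom_singleton_prod :
    MeasurableSpace.generateFrom {B : Set (ℕ∞ × (ℕ → E)) |
      ∃ (m : ℕ∞) (C : Set (ℕ → E)), MeasurableSet C ∧ B = {m} ×ˢ C} = Prod.instMeasurableSpace := by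
  refine le_antisymm (MeasurableSpace.generateFrom_le ?_) fun B hB => ?_
  · rintro _ ⟨m, C, hC, rfl⟩
    exact (measurableSet_singleton m).prod hC
  · have : B = ⋃ m : ℕ∞, {m} ×ˢ (Prod.mk m ⁻¹' B) := by
      ext ⟨m, z⟩
      simp
    rw [this]
    exact MeasurableSet.iUnion fun m => MeasurableSpace.measurableSet_generateFrom
      ⟨m, _, measurable_prodMk_left hB, rfl⟩

/-- In the i.i.d. model, the streams are independent, each with the law `jointLaw`. -/
lemma IsIIDModel.map_record (h : IsIIDModel P μ p q θ τ X)
    [IsProbabilityMeasure (μ.withDensity p)] [IsProbabilityMeasure (μ.withDensity q)] :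
    P.map (record τ X)
      = Measure.pi fun k => jointLaw (P.map (τ k)) (μ.withDensity p) (μ.withDensity q) := by
  have hτ := h.model.measurable_tau
  have hγ (k : Fin K) : IsProbabilityMeasure (P.map (τ k)) :=
    Measure.isProbabilityMeasure_map (hτ k).aemeasurable
  obtain ⟨e, he⟩ := exists_surjective_nat ℕ∞
  refine (Measure.pi_eq_generateFrom (C := fun _ => {B : Set (ℕ∞ × (ℕ → E)) |
      ∃ (m : ℕ∞) (C : Set (ℕ → E)), MeasurableSet C ∧ B = {m} ×ˢ C})
    (fun _ => generateFrom_singleton_prod) (fun _ => ?_) (fun _ => ⟨fun n => {e n} ×ˢ Set.univ,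
      fun n => ⟨e n, Set.univ, .univ, rfl⟩, fun n => measure_lt_top _ _, ?_⟩) ?_).symm
  · rintro _ ⟨m, C, hC, rfl⟩ _ ⟨m', C', hC', rfl⟩ hne
    obtain ⟨⟨n, z⟩, h1, h2⟩ := hne
    have h3 : n = m := h1.1
    have h4 : n = m' := h2.1
    subst h3 h4
    exact ⟨n, C ∩ C', hC.inter hC', by rw [Set.prod_inter_prod, Set.inter_self]⟩
  · ext ⟨m, z⟩
    obtain ⟨n, rfl⟩ := he m
    simp only [Set.mem_iUnion, Set.mem_prod, Set.mem_singleton_iff, Set.mem_univ, and_true,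
      iff_true]
    exact ⟨n, rfl⟩
  · intro s hs
    choose m C hC hsC using hs
    have hs' : MeasurableSet (Set.univ.pi s) := by
      refine MeasurableSet.univ_pi fun k => ?_
      rw [hsC]
      exact (measurableSet_singleton _).prod (hC k)
    have hM : MeasurableSet {ω | ∀ k, τ k ω = m k} := by
      simp only [Set.ofPred_forall]
      exact MeasurableSet.iInter fun k => hτ k (measurableSet_singleton (m k))
    have hjoint (k : Fin K) : jointLaw (P.map (τ k)) (μ.withDensity p) (μ.withDensity q) (s k)
        = P.map (τ k) {m k} * streamLaw (μ.withDensity p) (μ.withDensity q) (m k) (C k) := by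
      rw [hsC, jointLaw, Measure.compProd_apply_prod (measurableSet_singleton _) (hC k),
        Measure.restrict_singleton, lintegral_smul_measure, lintegral_dirac]
      rfl
    have htau : P {ω | ∀ k, τ k ω = m k} = ∏ k, P.map (τ k) {m k} := by
      have := h.indep_tau.measure_inter_preimage_eq_mul Finset.univ (sets := fun k => {m k})
        (fun k _ => measurableSet_singleton _)
      have e : {ω | ∀ k, τ k ω = m k} = ⋂ k ∈ (Finset.univ : Finset (Fin K)), τ k ⁻¹' {m k} := by
        ext ω; simp
      rw [e, this]
      exact Finset.prod_congr rfl fun k _ =>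
        (Measure.map_apply (hτ k) (measurableSet_singleton _)).symm
    have hpre : record τ X ⁻¹' Set.univ.pi s
        = {ω | ∀ k, τ k ω = m k} ∩ path X ⁻¹' Set.univ.pi C := by
      ext ω
      simp [record, hsC, forall_and]
    rw [Measure.map_apply h.measurable_record hs', hpre, Finset.prod_congr rfl fun k _ => hjoint k,
      Finset.prod_mul_distrib, ← htau]
    -- For a configuration of probability zero the model asserts nothing, but both sides vanish.
    by_cases h0 : P {ω | ∀ k, τ k ω = m k} = 0
    · rw [h0, zero_mul]
      exact measure_mono_null Set.inter_subset_left h0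
    · rw [← Measure.pi_pi, ← h.cond_map_path m h0,
        Measure.map_apply h.measurable_path (MeasurableSet.univ_pi hC), mul_comm,
        cond_mul_eq_inter hM]

/-- A system of independent streams observed on a probability space. -/
structure IsObserved (P : Measure Ω) (τ : Fin K → Ω → ℕ∞) (X : Fin K → ℕ → Ω → E)
    (ν : Measure E) (a b : E → ℝ) (θ : ℝ) (Pp Pq : Measure E) : Prop where
  density : IsDensityPair ν a b
  nonneg : 0 ≤ θ
  le_one : θ ≤ 1
  measurable_tau : ∀ k, Measurable (τ k)
  measurable_path : Measurable (path X)
  stream : ∀ k, IsStream ν a b θ Pp Pq (P.map (τ k))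
  map_record : P.map (record τ X) = Measure.pi fun k => jointLaw (P.map (τ k)) Pp Pq

lemma IsIIDModel.exists_isObserved (h : IsIIDModel P μ p q θ τ X) (hθ0 : 0 < θ) (hθ1 : θ < 1)
    (hK : 0 < K) :
    ∃ (ν : Measure E) (a b : E → ℝ) (Pp Pq : Measure E), IsProbabilityMeasure ν ∧
      IsProbabilityMeasure Pp ∧ IsProbabilityMeasure Pq ∧
      IsObserved P τ X ν a b θ Pp Pq := by
  have hp : IsProbabilityMeasure (μ.withDensity p) := ⟨by
    rw [withDensity_apply _ .univ, setLIntegral_univ]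
    exact h.model.lintegral_p ⟨0, hK⟩ 1 le_rfl⟩
  have hq : IsProbabilityMeasure (μ.withDensity q) := ⟨by
    rw [withDensity_apply _ .univ, setLIntegral_univ]
    exact h.model.lintegral_q ⟨0, hK⟩ 1 le_rfl⟩
  obtain ⟨ν, a, b, hν, hd, h1, h2⟩ := exists_density_pair (μ.withDensity p) (μ.withDensity q)
  refine ⟨ν, a, b, _, _, hν, hp, hq, hd, hθ0.le, hθ1.le, h.model.measurable_tau,
    h.measurable_path, fun k => ⟨hd, h1, h2, hθ0.le, hθ1.le, fun m => ?_⟩, h.map_record⟩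
  rw [Measure.map_apply (h.model.measurable_tau k) (measurableSet_singleton _)]
  exact h.geometric_tau k m

end Observation

/-! ### Filter identities on the probability space, given the full history. -/

section Filtering

variable {Ω E : Type*} [MeasurableSpace E] {K : ℕ} {X : Fin K → ℕ → Ω → E}

/-- All observations made up to time `t`. -/
@[reducible] def history (X : Fin K → ℕ → Ω → E) (t : ℕ) : MeasurableSpace Ω :=
  (historySigma K E t).comap (path X)

/-- The posterior probability that stream `k` has changed before time `t`, given its
observations up to time `t`. -/
noncomputable def weight (θ : ℝ) (a b : E → ℝ) (X : Fin K → ℕ → Ω → E) (t : ℕ) (ω : Ω) :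
    Fin K → ℝ := fun k => filt θ a b t (path X ω k)

lemma measurable_historySigma_eval {t s : ℕ} (h : s < t) (k : Fin K) :
    Measurable[historySigma K E t] fun z : Fin K → ℕ → E => z k s := by
  have h1 : Measurable[historySigma K E t] (fun (z : Fin K → ℕ → E) k (i : Fin t) => z k i) :=
    comap_measurable _
  have h2 : Measurable fun u : Fin K → Fin t → E => u k ⟨s, h⟩ := by fun_prop
  exact h2.comp h1

lemma historySigma_mono {s t : ℕ} (h : s ≤ t) : historySigma K E s ≤ historySigma K E t := by
  have h1 : Measurable[historySigma K E t] (fun (z : Fin K → ℕ → E) k (i : Fin t) => z k i) :=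
    comap_measurable _
  have h2 : Measurable (fun (u : Fin K → Fin t → E) k (i : Fin s) => u k ⟨i, i.2.trans_le h⟩) := by
    fun_prop
  exact measurable_iff_comap_le.1 (h2.comp h1)

lemma history_mono {s t : ℕ} (h : s ≤ t) : history X s ≤ history X t :=
  MeasurableSpace.comap_mono (historySigma_mono h)

lemma measurable_history_eval (k : Fin K) (t : ℕ) : Measurable[history X (t + 1)] (X k (t + 1)) :=
  (measurable_historySigma_eval t.lt_succ_self k).comp (comap_measurable (path X))

variable {ν : Measure E} {a b : E → ℝ} {θ : ℝ}

lemma measurable_filt_historySigma (h : IsDensityPair ν a b) (t : ℕ) (k : Fin K) :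
    Measurable[historySigma K E t] fun z : Fin K → ℕ → E => filt θ a b t (z k) := by
  have h1 : Measurable[historySigma K E t] (fun (z : Fin K → ℕ → E) k (i : Fin t) => z k i) :=
    comap_measurable _
  have h2 : @Measurable _ _ (historySigma K E t) (pathSigma E t)
      fun z : Fin K → ℕ → E => z k := by
    refine measurable_comap_iff.2 ?_
    exact (measurable_pi_apply k).comp h1
  exact (measurable_filt h t).comp h2

lemma measurable_weight (h : IsDensityPair ν a b) (t : ℕ) :
    Measurable[history X t] (weight θ a b X t) := by
  refine @measurable_pi_lambda Ω (Fin K) (fun _ => ℝ) (history X t) _ _ fun k => ?_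
  exact (measurable_filt_historySigma h t k).comp (comap_measurable (path X))

variable [MeasurableSpace Ω] {P : Measure Ω} {τ : Fin K → Ω → ℕ∞} {Pp Pq : Measure E}

lemma IsObserved.history_le (h : IsObserved P τ X ν a b θ Pp Pq) (t : ℕ) :
    history X t ≤ ‹MeasurableSpace Ω› := by
  refine (MeasurableSpace.comap_mono (historySigma_le t)).trans ?_
  exact measurable_iff_comap_le.1 h.measurable_path

lemma IsObserved.weight_mem (h : IsObserved P τ X ν a b θ Pp Pq) (t : ℕ) (ω : Ω) (k : Fin K) :
    0 ≤ weight θ a b X t ω k ∧ weight θ a b X t ω k ≤ 1 :=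
  filt_mem h.density h.nonneg h.le_one t _

lemma IsObserved.measurable_record (h : IsObserved P τ X ν a b θ Pp Pq) :
    Measurable (record τ X) :=
  measurable_pi_lambda _ fun k => (h.measurable_tau k).prodMk
    ((measurable_pi_apply k).comp h.measurable_path)

variable [IsProbabilityMeasure P] [IsProbabilityMeasure Pp] [IsProbabilityMeasure Pq]

lemma IsObserved.lintegral_mul_congr (h : IsObserved P τ X ν a b θ Pp Pq) {t : ℕ} (k : Fin K)
    {c c' : ℕ∞ × (ℕ → E) → ℝ≥0∞} (hc : Measurable c) (hc' : Measurable c')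
    (hcc : ∀ ψ : (ℕ → E) → ℝ≥0∞, Measurable[pathSigma E t] ψ →
      ∫⁻ x, c x * ψ x.2 ∂(jointLaw (P.map (τ k)) Pp Pq)
        = ∫⁻ x, c' x * ψ x.2 ∂(jointLaw (P.map (τ k)) Pp Pq))
    {φ : (Fin K → ℕ → E) → ℝ≥0∞} (hφ : Measurable[historySigma K E t] φ) :
    ∫⁻ ω, c (τ k ω, path X ω k) * φ (path X ω) ∂P
      = ∫⁻ ω, c' (τ k ω, path X ω k) * φ (path X ω) ∂P := by
  have hγ (k : Fin K) : IsProbabilityMeasure (P.map (τ k)) :=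
    Measure.isProbabilityMeasure_map (h.measurable_tau k).aemeasurable
  have hφ' : Measurable φ := hφ.mono (historySigma_le t) le_rfl
  have key := lintegral_pi_mul_congr (ρ := fun k => jointLaw (P.map (τ k)) Pp Pq) k hc hc' hcc hφ
  rw [← h.map_record, lintegral_map (by fun_prop) h.measurable_record,
    lintegral_map (by fun_prop) h.measurable_record] at key
  exact key

variable [IsProbabilityMeasure ν]

/-- The filter computes the posterior probability of a past change, given all observations. -/
lemma IsObserved.lintegral_change_lt (h : IsObserved P τ X ν a b θ Pp Pq) (t : ℕ) (k : Fin K)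
    {φ : (Fin K → ℕ → E) → ℝ≥0∞} (hφ : Measurable[historySigma K E t] φ) :
    ∫⁻ ω, (if τ k ω < (t : ℕ∞) then 1 else 0) * φ (path X ω) ∂P
      = ∫⁻ ω, ENNReal.ofReal (weight θ a b X t ω k) * φ (path X ω) ∂P := by
  have hγ : IsProbabilityMeasure (P.map (τ k)) :=
    Measure.isProbabilityMeasure_map (h.measurable_tau k).aemeasurable
  have hm : Measurable (filt θ a b t) := (measurable_filt h.density t).mono (pathSigma_le t) le_rfl
  refine h.lintegral_mul_congr k (t := t) (c := fun x => if x.1 < (t : ℕ∞) then 1 else 0)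
    (c' := fun x => ENNReal.ofReal (filt θ a b t x.2)) ?_ (by fun_prop) (fun ψ hψ => ?_) hφ
  · exact Measurable.ite (measurable_fst (MeasurableSet.of_discrete (s := {m | m < (t : ℕ∞)})))
      measurable_const measurable_const
  · rw [← ((h.stream k).isPosterior t ψ hψ).1]
    simp only [ite_mul, one_mul, zero_mul]

/-- Survival beyond the next time has conditional probability `1 - prior θ W = (1 - θ)(1 - W)`; this
is the expected gain of an active stream in the run length. -/
lemma IsObserved.lintegral_succ_le_change (h : IsObserved P τ X ν a b θ Pp Pq) (t : ℕ)
    (k : Fin K) {φ : (Fin K → ℕ → E) → ℝ≥0∞} (hφ : Measurable[historySigma K E t] φ) :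
    ∫⁻ ω, (if ((t + 1 : ℕ) : ℕ∞) ≤ τ k ω then 1 else 0) * φ (path X ω) ∂P
      = ∫⁻ ω, ENNReal.ofReal ((1 - θ) * (1 - weight θ a b X t ω k)) * φ (path X ω) ∂P := by
  have hγ : IsProbabilityMeasure (P.map (τ k)) :=
    Measure.isProbabilityMeasure_map (h.measurable_tau k).aemeasurable
  have hm : Measurable (filt θ a b t) := (measurable_filt h.density t).mono (pathSigma_le t) le_rfl
  refine h.lintegral_mul_congr k (t := t)
    (c := fun x => if ((t + 1 : ℕ) : ℕ∞) ≤ x.1 then 1 else 0)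
    (c' := fun x => ENNReal.ofReal ((1 - θ) * (1 - filt θ a b t x.2))) ?_ (by fun_prop)
    (fun ψ hψ => ?_) hφ
  · exact Measurable.ite (measurable_fst
      (MeasurableSet.of_discrete (s := {m | ((t + 1 : ℕ) : ℕ∞) ≤ m})))
      measurable_const measurable_const
  · have := (h.stream k).lintegral_succ_le ((h.stream k).isPosterior t) hψ
    simp only [ite_mul, one_mul, zero_mul]
    rw [this]
    refine lintegral_congr fun x => ?_
    rw [prior_filt h.density h.nonneg h.le_one]
    congr 2
    ring

lemma IsObserved.lintegral_resample (h : IsObserved P τ X ν a b θ Pp Pq)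
    (t : ℕ) {φ : (Fin K → ℕ → E) → ℝ≥0∞}
    (hφ : Measurable[historySigma K E (t + 1)] φ) :
    ∫⁻ ω, φ (path X ω) ∂P
      = ∫⁻ ω, ∫⁻ y, φ (fun k => Function.update (path X ω k) t (y k))
          * ∏ k, predDensity θ a b (weight θ a b X t ω k) (y k) ∂(Measure.pi fun _ => ν) ∂P := by
  have hγ (k : Fin K) : IsProbabilityMeasure (P.map (τ k)) :=
    Measure.isProbabilityMeasure_map (h.measurable_tau k).aemeasurable
  have hφ' : Measurable φ := hφ.mono (historySigma_le _) le_rfl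
  have hm : Measurable (filt θ a b t) := (measurable_filt h.density t).mono (pathSigma_le t) le_rfl
  have key := lintegral_pi_resample h.stream h.density h.nonneg h.le_one t hφ
  have hmeas : Measurable fun p : (Fin K → ℕ∞ × (ℕ → E)) × (Fin K → E) =>
      φ (fun k => Function.update (p.1 k).2 t (p.2 k))
        * ∏ k, predDensity θ a b (filt θ a b t (p.1 k).2) (p.2 k) := by
    refine (hφ'.comp (measurable_pi_lambda _ fun k => ?_)).mul
      (Finset.measurable_prod _ fun k _ => ?_)
    · exact (measurable_update_path t).comp
        (f := fun p : (Fin K → ℕ∞ × (ℕ → E)) × (Fin K → E) => ((p.1 k).2, p.2 k)) (by fun_prop)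
    · exact (measurable_predDensity (θ := θ) h.density).comp
        (f := fun p : (Fin K → ℕ∞ × (ℕ → E)) × (Fin K → E) => (filt θ a b t (p.1 k).2, p.2 k))
        (by fun_prop)
  rw [← h.map_record, lintegral_map (by fun_prop) h.measurable_record,
    lintegral_map hmeas.lintegral_prod_right' h.measurable_record] at key
  exact key

/-- The masked posterior probabilities evolve by the transition operator. -/
lemma IsObserved.lintegral_mask_weight_succ (h : IsObserved P τ X ν a b θ Pp Pq)
    {t : ℕ} {S : Ω → Finset (Fin K)} (hS : Measurable[history X t] S)
    {f : (Fin K → ℝ) → ℝ≥0∞} (hf : Measurable f) :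
    ∫⁻ ω, f (mask (S ω) (weight θ a b X (t + 1) ω)) ∂P
      = ∫⁻ ω, transition ν θ a b f (mask (S ω) (weight θ a b X t ω)) ∂P := by
  obtain ⟨S', hS', rfl⟩ := hS.exists_eq_measurable_comp (mY := historySigma K E t)
  have hW : Measurable[historySigma K E (t + 1)] fun (z : Fin K → ℕ → E) k =>
      filt θ a b (t + 1) (z k) :=
    @measurable_pi_lambda _ (Fin K) (fun _ => ℝ) (historySigma K E (t + 1)) _ _
      fun k => measurable_filt_historySigma h.density (t + 1) k
  have hφ : Measurable[historySigma K E (t + 1)] fun z : Fin K → ℕ → E =>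
      f (mask (S' z) fun k => filt θ a b (t + 1) (z k)) := by
    refine hf.comp ?_
    exact @measurable_of_finset_partition K _ _ (historySigma K E (t + 1)) _ S'
      (hS'.mono (historySigma_mono t.le_succ) le_rfl)
      (fun A z => mask A fun k => filt θ a b (t + 1) (z k)) fun A => (measurable_mask A).comp hW
  refine (h.lintegral_resample t hφ).trans (lintegral_congr fun ω => ?_)
  simp only [Function.comp_apply]
  -- Resampling uses the predictive densities of all streams, active or not; `transition_mask`
  -- trades them for those of the masked state.
  rw [← transition_mask h.density h.nonneg h.le_one hf, transition]
  refine lintegral_congr fun y => ?_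
  -- `S` depends on the first `t` observations only, so resampling coordinate `t` leaves it
  -- unchanged.
  have e : S' (fun k => Function.update (path X ω k) t (y k)) = S' (path X ω) := by
    refine hS'.factorsThrough ?_
    ext k s
    exact Function.update_of_ne s.2.ne _ _
  simp only [e, filt_succ_update h.density]
  rfl

end Filtering

/-! ### Procedures, their information, and the LFNR in terms of posteriors. -/

section Procedure

variable {Ω E : Type*} [MeasurableSpace E] {K : ℕ} {X : Fin K → ℕ → Ω → E}
  {S : ℕ → Ω → Finset (Fin K)}

lemma info_mono_succ (X : Fin K → ℕ → Ω → E) (S : ℕ → Ω → Finset (Fin K)) (t : ℕ) :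
    info X S t ≤ info X S (t + 1) :=
  le_sup_left.trans le_sup_left

lemma measurable_info_succ (X : Fin K → ℕ → Ω → E) (S : ℕ → Ω → Finset (Fin K)) (t : ℕ) :
    Measurable[info X S (t + 1)] (S (t + 1)) :=
  measurable_iff_comap_le.2 (le_sup_right.trans le_sup_left)

lemma measurableSet_info_observed (X : Fin K → ℕ → Ω → E) (S : ℕ → Ω → Finset (Fin K)) (t : ℕ)
    (k : Fin K) {A : Set E} (hA : MeasurableSet A) :
    MeasurableSet[info X S (t + 1)] {ω | k ∈ S (t + 1) ω ∧ X k (t + 1) ω ∈ A} := by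
  refine le_sup_right (α := MeasurableSpace Ω) _ ?_
  exact MeasurableSpace.measurableSet_generateFrom ⟨k, A, hA, rfl⟩

lemma IsProcedure.measurable_succ (hS : IsProcedure X S) (t : ℕ) :
    Measurable[info X S t] (S (t + 1)) := by
  rcases Nat.eq_zero_or_pos t with rfl | ht
  · have : S (0 + 1) = fun _ => Finset.univ := funext hS.start
    rw [this]
    exact measurable_const
  · exact @measurable_to_countable' _ _ _ _ (info X S t) _ fun A => hS.adapted t ht A

/-- Conditioning can thus be done on the full history, where streams are independent, and projected
down to the information by the tower property. -/
lemma IsProcedure.info_le_history (hS : IsProcedure X S) (t : ℕ) : info X S t ≤ history X t := by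
  induction t with
  | zero => exact bot_le
  | succ t ih =>
    have h1 : info X S t ≤ history X (t + 1) := ih.trans (history_mono t.le_succ)
    have h2 : Measurable[history X (t + 1)] (S (t + 1)) :=
      (hS.measurable_succ t).mono h1 le_rfl
    refine sup_le (sup_le h1 (measurable_iff_comap_le.1 h2)) ?_
    refine MeasurableSpace.generateFrom_le ?_
    rintro _ ⟨k, A, hA, rfl⟩
    have h3 : MeasurableSet[history X (t + 1)] {ω | k ∈ S (t + 1) ω} :=
      h2 (MeasurableSet.of_discrete (s := {A : Finset (Fin K) | k ∈ A}))
    exact h3.inter (measurable_history_eval k t hA)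

/-- Active sets are nested from time `1` on, so `T_k` reaches `s + 1` exactly when `k` is still
active then. The shift avoids `S 0`, which is unconstrained. -/
lemma le_detectionTime_iff {S : ℕ → Ω → Finset (Fin K)} (hS : IsProcedure X S) (k : Fin K)
    (ω : Ω) (s : ℕ) : ((s + 1 : ℕ) : ℕ∞) ≤ detectionTime S k ω ↔ k ∈ S (s + 1) ω := by
  constructor
  · intro hle
    by_contra hk
    have hmono (t : ℕ) (ht : s + 1 ≤ t) : S t ω ⊆ S (s + 1) ω := by
      induction t, ht using Nat.le_induction with
      | base => exact subset_rfl
      | succ t ht ih => exact (hS.anti t (by omega) ω).trans ih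
    have : detectionTime S k ω ≤ (s : ℕ∞) := by
      refine sSup_le ?_
      rintro _ ⟨t, _, hkt, rfl⟩
      by_contra hlt
      rw [Nat.cast_le, not_le] at hlt
      exact hk (hmono t hlt hkt)
    have := hle.trans this
    rw [Nat.cast_le] at this
    omega
  · intro hk
    exact le_sSup ⟨s + 1, Nat.le_add_left 1 s, hk, rfl⟩

/-- The posterior probabilities of active streams only depend on the available information. -/
lemma IsProcedure.measurable_active_weight (hS : IsProcedure X S) {ν : Measure E} {a b : E → ℝ}
    {θ : ℝ} (h : IsDensityPair ν a b) (t : ℕ) (k : Fin K) :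
    Measurable[info X S t] fun ω => if k ∈ S t ω then weight θ a b X t ω k else 0 := by
  induction t with
  | zero =>
    have : (fun ω => if k ∈ S 0 ω then weight θ a b X 0 ω k else 0) = fun _ => 0 := by
      ext ω
      simp [weight, filt]
    rw [this]
    exact measurable_const
  | succ t ih =>
    rcases isEmpty_or_nonempty E with hE | ⟨⟨e⟩⟩
    · have : IsEmpty Ω := ⟨fun ω => hE.false (X k 0 ω)⟩
      exact @measurable_of_empty _ _ (info X S (t + 1)) _ _ _
    have hk : MeasurableSet[info X S (t + 1)] {ω | k ∈ S (t + 1) ω} :=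
      measurable_info_succ X S t (MeasurableSet.of_discrete (s := {A : Finset (Fin K) | k ∈ A}))
    -- The observation where it is available and the fixed point `e` elsewhere: unlike `X k (t +
    -- 1)`, this is measurable for the information.
    let Y : Ω → E := fun ω => if k ∈ S (t + 1) ω then X k (t + 1) ω else e
    have hY : Measurable[info X S (t + 1)] Y := by
      intro A hA
      have : Y ⁻¹' A = {ω | k ∈ S (t + 1) ω ∧ X k (t + 1) ω ∈ A}
          ∪ ({ω | k ∈ S (t + 1) ω}ᶜ ∩ {_ω | e ∈ A}) := by
        ext ω
        by_cases hω : k ∈ S (t + 1) ω <;> simp [Y, hω]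
      rw [this]
      exact (measurableSet_info_observed X S t k hA).union
        (hk.compl.inter (@MeasurableSet.const _ (info X S (t + 1)) _))
    have hW : Measurable[info X S (t + 1)]
        fun ω => if k ∈ S t ω then weight θ a b X t ω k else 0 :=
      ih.mono (info_mono_succ X S t) le_rfl
    have hn := (measurable_nextState (θ := θ) h).comp (hW.prodMk hY)
    have : (fun ω => if k ∈ S (t + 1) ω then weight θ a b X (t + 1) ω k else 0)
        = fun ω => if k ∈ S (t + 1) ω then nextState θ a b
            (if k ∈ S t ω then weight θ a b X t ω k else 0) (Y ω) else 0 := by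
      ext ω
      by_cases hω : k ∈ S (t + 1) ω
      -- Deactivation is permanent, so an active stream was active before. At `t = 0` the set `S 0`
      -- is arbitrary, but the weight is zero.
      · have e1 : (if k ∈ S t ω then weight θ a b X t ω k else 0) = weight θ a b X t ω k := by
          rcases Nat.eq_zero_or_pos t with rfl | ht
          · simp [weight, filt]
          · rw [if_pos (hS.anti t ht ω hω)]
        simp only [hω, if_true, e1, Y]
        rfl
      · simp [hω]
    rw [this]
    exact Measurable.ite hk hn measurable_const

lemma IsProcedure.measurable_active_succ_weight (hS : IsProcedure X S) {ν : Measure E}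
    {a b : E → ℝ} {θ : ℝ} (h : IsDensityPair ν a b) (t : ℕ) (k : Fin K) :
    Measurable[info X S t] fun ω => if k ∈ S (t + 1) ω then weight θ a b X t ω k else 0 := by
  have hk : MeasurableSet[info X S t] {ω | k ∈ S (t + 1) ω} :=
    hS.measurable_succ t (MeasurableSet.of_discrete (s := {A : Finset (Fin K) | k ∈ A}))
  have : (fun ω => if k ∈ S (t + 1) ω then weight θ a b X t ω k else 0)
      = fun ω => if k ∈ S (t + 1) ω then (if k ∈ S t ω then weight θ a b X t ω k else 0) else 0 := by
    ext ω
    by_cases hω : k ∈ S (t + 1) ω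
    · rcases Nat.eq_zero_or_pos t with rfl | ht
      · simp [weight, filt]
      · rw [if_pos hω, if_pos hω, if_pos (hS.anti t ht ω hω)]
    · rw [if_neg hω, if_neg hω]
  rw [this]
  exact Measurable.ite hk (hS.measurable_active_weight h t k) measurable_const

variable [MeasurableSpace Ω] {P : Measure Ω} {τ : Fin K → Ω → ℕ∞} {Pp Pq : Measure E}
  {ν : Measure E} {a b : E → ℝ} {θ : ℝ}

lemma IsObserved.info_le (h : IsObserved P τ X ν a b θ Pp Pq) (hS : IsProcedure X S) (t : ℕ) :
    info X S t ≤ ‹MeasurableSpace Ω› :=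
  (hS.info_le_history t).trans (h.history_le t)

lemma IsObserved.measurable_procedure (h : IsObserved P τ X ν a b θ Pp Pq)
    {S : ℕ → Ω → Finset (Fin K)} (hS : IsProcedure X S) (t : ℕ) : Measurable (S (t + 1)) :=
  (hS.measurable_succ t).mono (h.info_le hS t) le_rfl

lemma IsObserved.measurableSet_lt (h : IsObserved P τ X ν a b θ Pp Pq) (t : ℕ) (k : Fin K) :
    MeasurableSet {ω | τ k ω < (t : ℕ∞)} :=
  h.measurable_tau k (MeasurableSet.of_discrete (s := {m | m < (t : ℕ∞)}))

lemma IsObserved.integrable_weight (h : IsObserved P τ X ν a b θ Pp Pq) [IsProbabilityMeasure P]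
    (t : ℕ) (k : Fin K) : Integrable (fun ω => weight θ a b X t ω k) P := by
  have hm : Measurable (fun ω => weight θ a b X t ω k) :=
    (measurable_pi_apply k).comp ((measurable_weight h.density t).mono (h.history_le t) le_rfl)
  refine Integrable.of_bound hm.aestronglyMeasurable 1 (Filter.Eventually.of_forall fun ω => ?_)
  obtain ⟨h0, h1⟩ := h.weight_mem t ω k
  rwa [Real.norm_of_nonneg h0]

/-- Weights are at most `1` and the mask value is `2`, so active streams are exactly the masked
coordinates that are at most `1`. -/
lemma IsObserved.integral_CD (h : IsObserved P τ X ν a b θ Pp Pq) [IsProbabilityMeasure P]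
    {S : ℕ → Ω → Finset (Fin K)} (hS : IsProcedure X S) (t : ℕ) :
    ∫ ω, CD S (t + 1) ω ∂P = K - (∫⁻ ω, ∑ k, (if mask (S (t + 1) ω) (weight θ a b X t ω) k ≤ 1
      then (1 : ℝ≥0∞) else 0) ∂P).toReal := by
  have hm : Measurable fun ω => ((S (t + 1) ω).card : ℝ) :=
    (Measurable.of_discrete (f := fun A : Finset (Fin K) => (A.card : ℝ))).comp
      (h.measurable_procedure hS t)
  have hint : Integrable (fun ω => ((S (t + 1) ω).card : ℝ)) P := by
    refine Integrable.of_bound hm.aestronglyMeasurable K (Filter.Eventually.of_forall fun ω => ?_)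
    rw [RCLike.norm_natCast]
    exact_mod_cast (Finset.card_le_univ _).trans (by simp)
  simp only [CD]
  rw [integral_sub (integrable_const _) hint, integral_const, probReal_univ, one_smul,
    integral_eq_lintegral_of_nonneg_ae (Filter.Eventually.of_forall fun ω => Nat.cast_nonneg _)
      hm.aestronglyMeasurable]
  congr 2
  refine lintegral_congr fun ω => ?_
  have e : (Finset.univ.filter fun k => mask (S (t + 1) ω) (weight θ a b X t ω) k ≤ 1)
      = S (t + 1) ω := active_mask fun k => (h.weight_mem t ω k).2
  rw [ENNReal.ofReal_natCast, Finset.sum_boole, e]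

variable [IsProbabilityMeasure P] [IsProbabilityMeasure Pp] [IsProbabilityMeasure Pq]
  [IsProbabilityMeasure ν]

/-- Testing against indicators of history events reduces the claim to
`IsObserved.lintegral_change_lt`. -/
lemma IsObserved.condExp_history (h : IsObserved P τ X ν a b θ Pp Pq) (t : ℕ) (k : Fin K) :
    P[{ω | τ k ω < (t : ℕ∞)}.indicator (fun _ => (1 : ℝ)) | history X t]
      =ᵐ[P] fun ω => weight θ a b X t ω k := by
  have hτ := h.measurableSet_lt t k
  have hm : Measurable[history X t] (fun ω => weight θ a b X t ω k) :=
    (measurable_pi_apply k).comp (measurable_weight h.density t)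
  have hm' := hm.mono (h.history_le t) le_rfl
  refine (ae_eq_condExp_of_forall_setIntegral_eq (h.history_le t)
    ((integrable_const (1 : ℝ)).indicator hτ)
    (fun s _ _ => (h.integrable_weight t k).integrableOn) (fun s hs _ => ?_)
    hm.stronglyMeasurable.aestronglyMeasurable).symm
  have hs' := h.history_le t s hs
  obtain ⟨B, hB, rfl⟩ := hs
  have hφ : Measurable[historySigma K E t] (B.indicator (1 : (Fin K → ℕ → E) → ℝ≥0∞)) :=
    Measurable.indicator (measurable_const (a := (1 : ℝ≥0∞))) hB
  have key := h.lintegral_change_lt t k hφ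
  have e1 : ∫⁻ ω in path X ⁻¹' B, ENNReal.ofReal (weight θ a b X t ω k) ∂P
      = ∫⁻ ω, ENNReal.ofReal (weight θ a b X t ω k)
        * B.indicator (1 : (Fin K → ℕ → E) → ℝ≥0∞) (path X ω) ∂P := by
    rw [← lintegral_indicator hs']
    refine lintegral_congr fun ω => ?_
    by_cases hω : path X ω ∈ B
    · rw [Set.indicator_of_mem (show ω ∈ path X ⁻¹' B from hω), Set.indicator_of_mem hω]
      simp
    · rw [Set.indicator_of_notMem (show ω ∉ path X ⁻¹' B from hω), Set.indicator_of_notMem hω]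
      simp
  have e2 : P ({ω | τ k ω < (t : ℕ∞)} ∩ path X ⁻¹' B)
      = ∫⁻ ω, (if τ k ω < (t : ℕ∞) then 1 else 0)
        * B.indicator (1 : (Fin K → ℕ → E) → ℝ≥0∞) (path X ω) ∂P := by
    rw [← lintegral_indicator_one (hτ.inter hs')]
    refine lintegral_congr fun ω => ?_
    by_cases h1 : τ k ω < (t : ℕ∞) <;> by_cases hω : path X ω ∈ B <;>
      simp [h1, hω]
  rw [integral_indicator hτ, Measure.restrict_restrict hτ, setIntegral_const, smul_eq_mul, mul_one,
    integral_eq_lintegral_of_nonneg_ae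
      (Filter.Eventually.of_forall fun ω => (h.weight_mem t ω k).1) hm'.aestronglyMeasurable,
    e1, ← key, ← e2, measureReal_def]

/-- Posterior probabilities with weights that are measurable with respect to the information. -/
lemma IsObserved.condExp_mul_indicator (h : IsObserved P τ X ν a b θ Pp Pq)
    (hS : IsProcedure X S) (t : ℕ) (k : Fin K) {c : Ω → ℝ} (hc : Measurable[info X S t] c)
    {C : ℝ} (hC : ∀ ω, ‖c ω‖ ≤ C)
    (hcw : Measurable[info X S t] fun ω => c ω * weight θ a b X t ω k) :
    P[fun ω => c ω * {ω | τ k ω < (t : ℕ∞)}.indicator (fun _ => (1 : ℝ)) ω | info X S t]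
      =ᵐ[P] fun ω => c ω * weight θ a b X t ω k := by
  have hle := hS.info_le_history t
  have hτ := h.measurableSet_lt t k
  have hc' : Measurable[history X t] c := hc.mono hle le_rfl
  have hc0 : Measurable c := hc'.mono (h.history_le t) le_rfl
  have hint : Integrable ({ω | τ k ω < (t : ℕ∞)}.indicator (fun _ => (1 : ℝ))) P :=
    (integrable_const (1 : ℝ)).indicator hτ
  have hint' : Integrable (c * {ω | τ k ω < (t : ℕ∞)}.indicator (fun _ => (1 : ℝ))) P :=
    hint.bdd_mul hc0.aestronglyMeasurable (Filter.Eventually.of_forall hC)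
  have h1 := condExp_mul_of_stronglyMeasurable_left (m := history X t) (μ := P)
    hc'.stronglyMeasurable hint' hint
  have h2 : P[c * {ω | τ k ω < (t : ℕ∞)}.indicator (fun _ => (1 : ℝ)) | history X t]
      =ᵐ[P] fun ω => c ω * weight θ a b X t ω k := by
    filter_upwards [h1, h.condExp_history t k] with ω h3 h4
    rw [h3, Pi.mul_apply, h4]
  -- Tower property: the inner conditional expectation is `c W`, which is already measurable for the
  -- smaller σ-algebra.
  have h3 := condExp_condExp_of_le (μ := P)
    (f := c * {ω | τ k ω < (t : ℕ∞)}.indicator (fun _ => (1 : ℝ))) hle (h.history_le t)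
  have h4 : Integrable (fun ω => c ω * weight θ a b X t ω k) P :=
    (h.integrable_weight t k).bdd_mul hc0.aestronglyMeasurable (Filter.Eventually.of_forall hC)
  have h5 := condExp_congr_ae (m := info X S t) h2
  rw [condExp_of_stronglyMeasurable (h.info_le hS t) hcw.stronglyMeasurable h4] at h5
  exact h3.symm.trans h5

/-- Multiply by the indicator of `{k ∈ S_t}`, an event of the information on which the filter value
is available. For inactive streams the two may differ, but the selection rule ignores them. -/
lemma IsObserved.postProb_eq (h : IsObserved P τ X ν a b θ Pp Pq) (hS : IsProcedure X S)
    {t : ℕ} (ht : 1 ≤ t) :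
    ∀ᵐ ω ∂P, ∀ k ∈ S t ω, postProb (info X S t) P τ t k ω = weight θ a b X t ω k := by
  obtain ⟨t, rfl⟩ := Nat.exists_eq_add_of_le' ht
  refine ae_all_iff.2 fun k => ?_
  have hk : MeasurableSet[info X S (t + 1)] {ω | k ∈ S (t + 1) ω} :=
    measurable_info_succ X S t (MeasurableSet.of_discrete (s := {A : Finset (Fin K) | k ∈ A}))
  set c : Ω → ℝ := fun ω => if k ∈ S (t + 1) ω then 1 else 0 with hc
  have hcm : Measurable[info X S (t + 1)] c := Measurable.ite hk measurable_const measurable_const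
  have hcb (ω : Ω) : ‖c ω‖ ≤ 1 := by
    simp only [hc]; split_ifs <;> simp
  have hcw : Measurable[info X S (t + 1)] fun ω => c ω * weight θ a b X (t + 1) ω k := by
    have := hS.measurable_active_weight (θ := θ) h.density (t + 1) k
    simpa [hc, ite_mul] using this
  have hint : Integrable ({ω | τ k ω < ((t + 1 : ℕ) : ℕ∞)}.indicator (fun _ => (1 : ℝ))) P :=
    (integrable_const (1 : ℝ)).indicator (h.measurableSet_lt (t + 1) k)
  have hint' : Integrable (c * {ω | τ k ω < ((t + 1 : ℕ) : ℕ∞)}.indicator (fun _ => (1 : ℝ))) P :=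
    hint.bdd_mul (hcm.mono (h.info_le hS _) le_rfl).aestronglyMeasurable
      (Filter.Eventually.of_forall hcb)
  have h1 := h.condExp_mul_indicator hS (t + 1) k hcm hcb hcw
  have h2 := condExp_mul_of_stronglyMeasurable_left (m := info X S (t + 1)) (μ := P)
    hcm.stronglyMeasurable hint' hint
  filter_upwards [h1, h2] with ω h1 h2 hω
  have h3 := h2.symm.trans h1
  simp only [hc, hω, if_true, Pi.mul_apply, one_mul] at h3
  exact h3

/-- The local false non-discovery rate is the average posterior probability of a change. -/
lemma IsObserved.LFNR_succ (h : IsObserved P τ X ν a b θ Pp Pq) (hS : IsProcedure X S) (t : ℕ) :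
    LFNR P τ X S (t + 1) =ᵐ[P] fun ω =>
      (∑ k ∈ S (t + 1) ω, weight θ a b X t ω k) / (max (S (t + 1) ω).card 1 : ℕ) := by
  have hSm := hS.measurable_succ t
  -- These coefficients write the average over the random set `S_{t+1}` as a fixed finite sum whose
  -- weights are known at time `t`.
  let c : Fin K → Ω → ℝ := fun k ω =>
    if k ∈ S (t + 1) ω then ((max (S (t + 1) ω).card 1 : ℕ) : ℝ)⁻¹ else 0
  have hcm (k : Fin K) : Measurable[info X S t] (c k) :=
    (Measurable.of_discrete (f := fun A : Finset (Fin K) =>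
      if k ∈ A then ((max A.card 1 : ℕ) : ℝ)⁻¹ else 0)).comp hSm
  have hcb (k : Fin K) (ω : Ω) : ‖c k ω‖ ≤ 1 := by
    simp only [c]
    split_ifs
    · rw [norm_inv, RCLike.norm_natCast]
      exact inv_le_one_of_one_le₀ (by exact_mod_cast le_max_right _ _)
    · simp
  have hcw (k : Fin K) : Measurable[info X S t] fun ω => c k ω * weight θ a b X t ω k := by
    have e : (fun ω => c k ω * weight θ a b X t ω k) = fun ω => c k ω
        * (if k ∈ S (t + 1) ω then weight θ a b X t ω k else 0) := by
      ext ω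
      by_cases hω : k ∈ S (t + 1) ω <;> simp [c, hω]
    rw [e]
    exact (hcm k).mul (hS.measurable_active_succ_weight h.density t k)
  have hsum (g : Fin K → Ω → ℝ) (ω : Ω) :
      (∑ k ∈ S (t + 1) ω, g k ω) / (max (S (t + 1) ω).card 1 : ℕ) = ∑ k, c k ω * g k ω := by
    simp only [c, ite_mul, zero_mul, Finset.sum_ite_mem, Finset.univ_inter]
    rw [← Finset.mul_sum, div_eq_inv_mul]
  have hFNP : FNP τ S (t + 1) = ∑ k, fun ω =>
      c k ω * {ω | τ k ω < (t : ℕ∞)}.indicator (fun _ => (1 : ℝ)) ω := by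
    ext ω
    rw [Finset.sum_apply, ← hsum fun k ω => {ω | τ k ω < (t : ℕ∞)}.indicator (fun _ => (1 : ℝ)) ω]
    simp [FNP, Set.indicator_apply]
  have hint (k : Fin K) : Integrable (fun ω =>
      c k ω * {ω | τ k ω < (t : ℕ∞)}.indicator (fun _ => (1 : ℝ)) ω) P :=
    ((integrable_const (1 : ℝ)).indicator (h.measurableSet_lt t k)).bdd_mul
      ((hcm k).mono (h.info_le hS t) le_rfl).aestronglyMeasurable
      (Filter.Eventually.of_forall (hcb k))
  have h1 := condExp_finsetSum (s := Finset.univ) (fun k _ => hint k) (info X S t)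
  have h2 : ∀ᵐ ω ∂P, ∀ k, (P[fun ω => c k ω * {ω | τ k ω < (t : ℕ∞)}.indicator
      (fun _ => (1 : ℝ)) ω | info X S t]) ω = c k ω * weight θ a b X t ω k :=
    ae_all_iff.2 fun k => h.condExp_mul_indicator hS t k (hcm k) (hcb k) (hcw k)
  simp only [LFNR]
  rw [hFNP]
  filter_upwards [h1, h2] with ω h1 h2
  rw [h1, Finset.sum_apply, hsum fun k ω => weight θ a b X t ω k]
  exact Finset.sum_congr rfl fun k _ => h2 k

end Procedure

/-! ### Optimality of the proposed procedure by induction on time. -/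

section Optimality

variable {Ω E : Type*} [MeasurableSpace Ω] [MeasurableSpace E] {K : ℕ} {P : Measure Ω}
  {τ : Fin K → Ω → ℕ∞} {X : Fin K → ℕ → Ω → E} {α : ℝ}

/-- `proposedAux` carries `F_t` together with `S_{t+1}`; once its σ-algebra is identified with
`info`, the update rule unfolds definitionally. -/
lemma info_proposed (P : Measure Ω) (τ : Fin K → Ω → ℕ∞) (X : Fin K → ℕ → Ω → E) (α : ℝ)
    (t : ℕ) : info X (proposed P τ X α) t = (proposedAux P τ X α t).1 := by
  induction t with
  | zero => rfl
  | succ t ih =>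
    rw [info, ih]
    rfl

lemma proposed_succ (P : Measure Ω) (τ : Fin K → Ω → ℕ∞) (X : Fin K → ℕ → Ω → E) (α : ℝ)
    {t : ℕ} (ht : 1 ≤ t) (ω : Ω) :
    proposed P τ X α (t + 1) ω = oneStep α (proposed P τ X α t ω)
      fun k => postProb (info X (proposed P τ X α) t) P τ t k ω := by
  obtain ⟨t, rfl⟩ := Nat.exists_eq_add_of_le' ht
  rw [info_proposed]
  rfl

/-- The chosen version of a conditional expectation is measurable for the conditioning σ-algebra, so
adaptedness holds exactly and not merely up to null sets. -/
lemma isProcedure_proposed (P : Measure Ω) (τ : Fin K → Ω → ℕ∞) (X : Fin K → ℕ → Ω → E)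
    (α : ℝ) : IsProcedure X (proposed P τ X α) where
  start _ := rfl
  anti t ht ω := by
    rw [proposed_succ P τ X α ht]
    exact oneStep_subset _ _ _
  adapted t ht A := by
    have hS : Measurable[info X (proposed P τ X α) t] (proposed P τ X α t) := by
      obtain ⟨t, rfl⟩ := Nat.exists_eq_add_of_le' ht
      exact measurable_info_succ X _ t
    have hW : Measurable[info X (proposed P τ X α) t]
        fun ω k => postProb (info X (proposed P τ X α) t) P τ t k ω :=
      @measurable_pi_lambda _ (Fin K) (fun _ => ℝ) (info X (proposed P τ X α) t) _ _
        fun k => stronglyMeasurable_condExp.measurable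
    have h1 := @measurable_of_finset_partition K _ _ (info X (proposed P τ X α) t) _
      (proposed P τ X α t) hS
      (fun A ω => oneStep α A fun k => postProb (info X (proposed P τ X α) t) P τ t k ω)
      (fun A => (measurable_oneStep α A).comp hW)
    convert h1 (measurableSet_singleton A) using 1
    ext ω
    rw [Set.mem_ofPred_eq, proposed_succ P τ X α ht]
    rfl

variable {ν : Measure E} {a b : E → ℝ} {θ : ℝ} {Pp Pq : Measure E}
  [IsProbabilityMeasure P] [IsProbabilityMeasure Pp] [IsProbabilityMeasure Pq]
  [IsProbabilityMeasure ν]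

lemma IsObserved.proposed_succ_ae (h : IsObserved P τ X ν a b θ Pp Pq) {t : ℕ} (ht : 1 ≤ t) :
    ∀ᵐ ω ∂P, proposed P τ X α (t + 1) ω
      = oneStep α (proposed P τ X α t ω) (weight θ a b X t ω) := by
  filter_upwards [h.postProb_eq (isProcedure_proposed P τ X α) ht] with ω hω
  rw [proposed_succ P τ X α ht]
  exact oneStep_congr hω

lemma IsObserved.proposed_mem_controlled (h : IsObserved P τ X ν a b θ Pp Pq) (hα : 0 ≤ α) :
    proposed P τ X α ∈ controlled P τ X α := by
  refine ⟨isProcedure_proposed P τ X α, fun t ht => ?_⟩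
  obtain ⟨t, rfl⟩ := Nat.exists_eq_add_of_le' ht
  rcases Nat.eq_zero_or_pos t with rfl | ht0
  · filter_upwards [h.LFNR_succ (isProcedure_proposed P τ X α) 0] with ω hω
    rw [hω]
    simpa [weight, filt] using hα
  · filter_upwards [h.LFNR_succ (isProcedure_proposed P τ X α) t, h.proposed_succ_ae (α := α) ht0]
      with ω hω hω'
    rw [hω, hω', div_le_iff₀ (by positivity)]
    refine (sum_oneStep_le hα _ _).trans ?_
    gcongr
    exact le_max_left _ _

/-- For nonempty sets the `∨ 1` in the denominator is void; for empty sets both sides are zero. -/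
lemma IsObserved.sum_weight_le (h : IsObserved P τ X ν a b θ Pp Pq)
    {S : ℕ → Ω → Finset (Fin K)} (hS : S ∈ controlled P τ X α) (t : ℕ) :
    ∀ᵐ ω ∂P, ∑ k ∈ S (t + 1) ω, weight θ a b X t ω k ≤ α * (S (t + 1) ω).card := by
  filter_upwards [h.LFNR_succ hS.1 t, hS.2 (t + 1) (Nat.le_add_left 1 t)] with ω h1 h2
  rw [h1, div_le_iff₀ (by positivity)] at h2
  rcases Finset.eq_empty_or_nonempty (S (t + 1) ω) with h0 | h0
  · simp [h0]
  · rwa [max_eq_left (Finset.card_pos.2 h0)] at h2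

/-- The proposed procedure maximizes the expectation of every symmetric function of the active
posterior probabilities which decreases in each of them. -/
lemma IsObserved.lintegral_mask_le_proposed (h : IsObserved P τ X ν a b θ Pp Pq) (hα : 0 ≤ α)
    {S : ℕ → Ω → Finset (Fin K)} (hS : S ∈ controlled P τ X α) (t : ℕ)
    {f : (Fin K → ℝ) → ℝ≥0∞} (hf : SymmAntitone f) (hm : Measurable f) {C : ℝ≥0∞} (hC : C ≠ ∞)
    (hfC : ∀ x, f x ≤ C) :
    ∫⁻ ω, f (mask (S (t + 1) ω) (weight θ a b X t ω)) ∂P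
      ≤ ∫⁻ ω, f (mask (proposed P τ X α (t + 1) ω) (weight θ a b X t ω)) ∂P := by
  induction t generalizing f with
  | zero =>
    refine lintegral_mono fun ω => ?_
    rw [hS.1.start, (isProcedure_proposed P τ X α).start]
  | succ t ih =>
    have hle (ω : Ω) (k : Fin K) : weight θ a b X (t + 1) ω k ≤ 1 := (h.weight_mem _ _ _).2
    -- The last selection is absorbed into the test function: `g` is the value of `f` after the
    -- one-step rule, and is again symmetric and decreasing.
    set g : (Fin K → ℝ) → ℝ≥0∞ := fun x => f (stepState α x) with hg
    have hgs : SymmAntitone g := hf.comp_stepState hα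
    have hgm : Measurable g := hm.comp (measurable_stepState α)
    have hgC (x) : g x ≤ C := hfC _
    have hfin (x) : g x ≠ ∞ := ((hgC x).trans_lt hC.lt_top).ne
    have htr {S : ℕ → Ω → Finset (Fin K)} (hS : IsProcedure X S) :
        ∫⁻ ω, g (mask (S (t + 1) ω) (weight θ a b X (t + 1) ω)) ∂P
          = ∫⁻ ω, transition ν θ a b g (mask (S (t + 1) ω) (weight θ a b X t ω)) ∂P :=
      h.lintegral_mask_weight_succ
        ((hS.measurable_succ t).mono (hS.info_le_history t) le_rfl) hgm
    calc ∫⁻ ω, f (mask (S (t + 1 + 1) ω) (weight θ a b X (t + 1) ω)) ∂P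
        ≤ ∫⁻ ω, g (mask (S (t + 1) ω) (weight θ a b X (t + 1) ω)) ∂P := by
          -- The constraint makes the competitor's last selection admissible almost surely, so
          -- replacing it by the one-step rule cannot lower `f`.
          refine lintegral_mono_ae ?_
          filter_upwards [h.sum_weight_le hS (t + 1)] with ω hω
          have hsub := hS.1.anti (t + 1) (Nat.le_add_left 1 t) ω
          rw [← mask_mask _ _ hsub]
          refine hf.mask_le_stepState hα ?_ ?_
          · rwa [active_mask (hle ω)]
          · refine le_trans (le_of_eq ?_) hω
            exact Finset.sum_congr rfl fun k hk => if_pos (hsub hk)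
      _ = ∫⁻ ω, transition ν θ a b g (mask (S (t + 1) ω) (weight θ a b X t ω)) ∂P := htr hS.1
      _ ≤ ∫⁻ ω, transition ν θ a b g
            (mask (proposed P τ X α (t + 1) ω) (weight θ a b X t ω)) ∂P :=
          -- The induction hypothesis is used for the new function `transition g`, which is why `f`
          -- is generalized.
          ih (hgs.transition h.density h.nonneg h.le_one hgm hfin)
            (measurable_transition h.density hgm)
            (transition_le h.density h.nonneg h.le_one hgC)
      _ = ∫⁻ ω, g (mask (proposed P τ X α (t + 1) ω) (weight θ a b X (t + 1) ω)) ∂P :=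
          (htr (isProcedure_proposed P τ X α)).symm
      _ = ∫⁻ ω, f (mask (proposed P τ X α (t + 1 + 1) ω) (weight θ a b X (t + 1) ω)) ∂P := by
          refine lintegral_congr_ae ?_
          filter_upwards [h.proposed_succ_ae (α := α) (Nat.le_add_left 1 t)] with ω hω
          rw [hω, hg]
          simp only [stepState_mask (hle ω)]

lemma lintegral_sum_mask_le_proposed (h : IsObserved P τ X ν a b θ Pp Pq) (hα : 0 ≤ α)
    {S : ℕ → Ω → Finset (Fin K)} (hS : S ∈ controlled P τ X α) (t : ℕ) {φ : ℝ → ℝ≥0∞}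
    (hφ : Antitone φ) (hφ1 : ∀ r, φ r ≤ 1) :
    ∫⁻ ω, ∑ k, φ (mask (S (t + 1) ω) (weight θ a b X t ω) k) ∂P
      ≤ ∫⁻ ω, ∑ k, φ (mask (proposed P τ X α (t + 1) ω) (weight θ a b X t ω) k) ∂P := by
  have hm : Measurable φ := hφ.measurable
  refine h.lintegral_mask_le_proposed hα hS t (f := fun x => ∑ k, φ (x k)) (symmAntitone_sum hφ)
    (by fun_prop) (C := K) (ENNReal.natCast_ne_top K) fun x => ?_
  calc ∑ k, φ (x k) ≤ ∑ _k : Fin K, (1 : ℝ≥0∞) := Finset.sum_le_sum fun k _ => hφ1 _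
    _ = K := by simp

lemma toNat_min_eq_sum (n : ℕ∞) (t : ℕ) :
    (((min n (t : ℕ∞)).toNat : ℕ) : ℝ≥0∞)
      = ∑ s ∈ Finset.range t, if ((s + 1 : ℕ) : ℕ∞) ≤ n then 1 else 0 := by
  have hle : min n (t : ℕ∞) ≤ t := min_le_right _ _
  obtain ⟨m, hm⟩ := ENat.ne_top_iff_exists.1 (hle.trans_lt (ENat.natCast_lt_top t)).ne
  rw [← hm, ENat.toNat_natCast, Finset.sum_boole]
  have hmt : m ≤ t := by rw [← hm] at hle; exact_mod_cast hle
  have : (Finset.range t).filter (fun s => ((s + 1 : ℕ) : ℕ∞) ≤ n) = Finset.range m := by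
    ext s
    rw [Finset.mem_filter, Finset.mem_range, Finset.mem_range]
    constructor
    · rintro ⟨h1, h2⟩
      have : ((s + 1 : ℕ) : ℕ∞) ≤ m := by
        rw [hm]; exact le_min h2 (by exact_mod_cast h1)
      exact_mod_cast this
    · intro h1
      refine ⟨h1.trans_le hmt, le_trans (b := (m : ℕ∞)) (by exact_mod_cast h1) ?_⟩
      rw [hm]
      exact min_le_left _ _
  rw [this, Finset.card_range]

/-- Here `T_k ∧ τ_k ∧ t` counts the `s < t` with `τ_k ≥ s + 1` and `k ∈ S_{s+1}`. The second event
is known at time `s`, and the first then has conditional probability `(1 - θ)(1 - W_{k,s})`. -/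
lemma IsObserved.integral_RL (h : IsObserved P τ X ν a b θ Pp Pq)
    {S : ℕ → Ω → Finset (Fin K)} (hS : IsProcedure X S) (t : ℕ) :
    ∫ ω, RL τ S t ω ∂P = (∑ s ∈ Finset.range t, ∫⁻ ω, ∑ k,
      ENNReal.ofReal ((1 - θ) * (1 - max 0 (mask (S (s + 1) ω) (weight θ a b X s ω) k)))
        ∂P).toReal := by
  have hmem (s : ℕ) (k : Fin K) : MeasurableSet {ω | k ∈ S (s + 1) ω} :=
    measurable_finset_iff.1 (h.measurable_procedure hS s) k
  have hτ (s : ℕ) (k : Fin K) : MeasurableSet {ω | ((s + 1 : ℕ) : ℕ∞) ≤ τ k ω} :=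
    h.measurable_tau k (MeasurableSet.of_discrete (s := {m | ((s + 1 : ℕ) : ℕ∞) ≤ m}))
  have hRL (ω : Ω) : ENNReal.ofReal (RL τ S t ω) = ∑ k, ∑ s ∈ Finset.range t,
      (if ((s + 1 : ℕ) : ℕ∞) ≤ τ k ω then 1 else 0) * (if k ∈ S (s + 1) ω then 1 else 0) := by
    rw [RL, ENNReal.ofReal_sum_of_nonneg fun k _ => Nat.cast_nonneg _]
    refine Finset.sum_congr rfl fun k _ => ?_
    rw [ENNReal.ofReal_natCast, toNat_min_eq_sum]
    refine Finset.sum_congr rfl fun s _ => ?_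
    simp only [le_min_iff, le_detectionTime_iff hS]
    by_cases h1 : k ∈ S (s + 1) ω <;> by_cases h2 : ((s + 1 : ℕ) : ℕ∞) ≤ τ k ω <;>
      simp only [h1, h2, and_true, and_false, if_true, if_false, mul_one, mul_zero]
  have hterm (s : ℕ) (k : Fin K) : Measurable fun ω =>
      (if ((s + 1 : ℕ) : ℕ∞) ≤ τ k ω then (1 : ℝ≥0∞) else 0)
        * (if k ∈ S (s + 1) ω then 1 else 0) :=
    (Measurable.ite (hτ s k) measurable_const measurable_const).mul
      (Measurable.ite (hmem s k) measurable_const measurable_const)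
  have hnn (ω : Ω) : 0 ≤ RL τ S t ω := Finset.sum_nonneg fun k _ => Nat.cast_nonneg _
  have hRLm : Measurable (RL τ S t) := by
    have e : RL τ S t = fun ω => (∑ k, ∑ s ∈ Finset.range t,
        (if ((s + 1 : ℕ) : ℕ∞) ≤ τ k ω then (1 : ℝ≥0∞) else 0)
          * (if k ∈ S (s + 1) ω then 1 else 0)).toReal := by
      ext ω
      rw [← hRL, ENNReal.toReal_ofReal (hnn ω)]
    rw [e]
    exact (Finset.measurable_sum _ fun k _ => Finset.measurable_sum _ fun s _ =>
      hterm s k).ennreal_toReal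
  rw [integral_eq_lintegral_of_nonneg_ae (Filter.Eventually.of_forall hnn)
    hRLm.aestronglyMeasurable]
  congr 1
  simp only [hRL]
  rw [lintegral_finsetSum _ fun k _ => Finset.measurable_sum _ fun s _ => hterm s k]
  simp only [lintegral_finsetSum (Finset.range t) fun s _ => hterm s _]
  rw [Finset.sum_comm]
  refine Finset.sum_congr rfl fun s _ => ?_
  have hw (k : Fin K) : Measurable fun ω => mask (S (s + 1) ω) (weight θ a b X s ω) k :=
    (measurable_pi_apply k).comp (measurable_of_finset_partition (h.measurable_procedure hS s)
      (F := fun A ω => mask A (weight θ a b X s ω)) fun A => (measurable_mask A).comp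
        ((measurable_weight h.density s).mono (h.history_le s) le_rfl))
  rw [lintegral_finsetSum _ fun k _ => by have := hw k; fun_prop]
  refine Finset.sum_congr rfl fun k _ => ?_
  have hhist : MeasurableSet[history X s] {ω | k ∈ S (s + 1) ω} :=
    hS.info_le_history s _
      (hS.measurable_succ s (MeasurableSet.of_discrete (s := {A : Finset (Fin K) | k ∈ A})))
  obtain ⟨B, hB, hBeq⟩ := hhist
  have hφ : Measurable[historySigma K E s] (B.indicator (1 : (Fin K → ℕ → E) → ℝ≥0∞)) :=
    Measurable.indicator (measurable_const (a := (1 : ℝ≥0∞))) hB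
  have hind (ω : Ω) : B.indicator (1 : (Fin K → ℕ → E) → ℝ≥0∞) (path X ω)
      = if k ∈ S (s + 1) ω then 1 else 0 := by
    have : path X ω ∈ B ↔ k ∈ S (s + 1) ω := by
      rw [← Set.mem_preimage, hBeq, Set.mem_ofPred_eq]
    by_cases hω : k ∈ S (s + 1) ω
    · rw [if_pos hω, Set.indicator_of_mem (this.2 hω), Pi.one_apply]
    · rw [if_neg hω, Set.indicator_of_notMem (fun h' => hω (this.1 h'))]
  have key := h.lintegral_succ_le_change s k hφ
  simp only [hind] at key
  rw [key]
  refine lintegral_congr fun ω => ?_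
  by_cases hω : k ∈ S (s + 1) ω
  · simp only [mask, hω, if_true, mul_one, max_eq_right (h.weight_mem s ω k).1]
  · simp only [mask, hω, if_false, mul_zero]
    -- At the inactive state `2` the argument is `-(1 - θ) ≤ 0`, so the stream contributes nothing.
    rw [ENNReal.ofReal_of_nonpos]
    have h2 : max (0 : ℝ) 2 = 2 := max_eq_right zero_le_two
    rw [h2]
    nlinarith [h.le_one]

lemma ofReal_one_sub_antitone (hθ1 : θ ≤ 1) :
    Antitone fun r : ℝ => ENNReal.ofReal ((1 - θ) * (1 - max 0 r)) := by
  intro r s hrs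
  refine ENNReal.ofReal_le_ofReal (mul_le_mul_of_nonneg_left ?_ (by linarith))
  gcongr

/-- The `max 0` is there for this bound, which must hold at negative states too. -/
lemma ofReal_one_sub_le_one (hθ0 : 0 ≤ θ) (hθ1 : θ ≤ 1) (r : ℝ) :
    ENNReal.ofReal ((1 - θ) * (1 - max 0 r)) ≤ 1 := by
  rw [ENNReal.ofReal_le_one]
  have : 0 ≤ max 0 r := le_max_left _ _
  nlinarith

lemma lintegral_sum_ne_top (Y : Ω → Fin K → ℝ) {φ : ℝ → ℝ≥0∞} (hφ1 : ∀ r, φ r ≤ 1) :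
    ∫⁻ ω, ∑ k, φ (Y ω k) ∂P ≠ ∞ := by
  refine ne_top_of_le_ne_top (b := (K : ℝ≥0∞)) (ENNReal.natCast_ne_top K) ?_
  calc ∫⁻ ω, ∑ k, φ (Y ω k) ∂P ≤ ∫⁻ _ω, (K : ℝ≥0∞) ∂P := by
        refine lintegral_mono fun ω => ?_
        calc ∑ k, φ (Y ω k) ≤ ∑ _k : Fin K, (1 : ℝ≥0∞) := Finset.sum_le_sum fun k _ => hφ1 _
          _ = K := by simp
    _ = K := by simp

lemma IsObserved.integral_RL_le (h : IsObserved P τ X ν a b θ Pp Pq) (hα : 0 ≤ α)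
    {S : ℕ → Ω → Finset (Fin K)} (hS : S ∈ controlled P τ X α) (t : ℕ) :
    ∫ ω, RL τ S t ω ∂P ≤ ∫ ω, RL τ (proposed P τ X α) t ω ∂P := by
  have h1 := ofReal_one_sub_le_one h.nonneg h.le_one
  rw [h.integral_RL hS.1, h.integral_RL (isProcedure_proposed P τ X α)]
  refine ENNReal.toReal_mono ?_ (Finset.sum_le_sum fun s _ =>
    lintegral_sum_mask_le_proposed h hα hS s (ofReal_one_sub_antitone h.le_one) h1)
  exact ENNReal.sum_ne_top.2 fun s _ => lintegral_sum_ne_top _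
    (φ := fun r => ENNReal.ofReal ((1 - θ) * (1 - max 0 r))) h1

lemma IsObserved.le_integral_CD (h : IsObserved P τ X ν a b θ Pp Pq) (hα : 0 ≤ α)
    {S : ℕ → Ω → Finset (Fin K)} (hS : S ∈ controlled P τ X α) (t : ℕ) :
    ∫ ω, CD (proposed P τ X α) (t + 1) ω ∂P ≤ ∫ ω, CD S (t + 1) ω ∂P := by
  have h1 (r : ℝ) : (if r ≤ 1 then (1 : ℝ≥0∞) else 0) ≤ 1 := by split_ifs <;> simp
  have h2 : Antitone fun r : ℝ => if r ≤ 1 then (1 : ℝ≥0∞) else 0 := by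
    intro r s hrs
    by_cases hs : s ≤ 1
    · simp [hs, hrs.trans hs]
    · simp [hs]
  rw [h.integral_CD hS.1, h.integral_CD (isProcedure_proposed P τ X α)]
  refine sub_le_sub_left (ENNReal.toReal_mono (lintegral_sum_ne_top (P := P) _ h1) ?_) _
  exact lintegral_sum_mask_le_proposed h hα hS t h2 h1

end Optimality

end CompoundDetection

theorem theorem4 {Ω E : Type*} [MeasurableSpace Ω] [MeasurableSpace E] {K : ℕ}
    (P : Measure Ω) [IsProbabilityMeasure P] (μ : Measure E) (p q : E → ℝ≥0∞)
    (θ : ℝ) (hθ0 : 0 < θ) (hθ1 : θ < 1) (α : ℝ) (hα0 : 0 < α) (hα1 : α ≤ 1)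
    (τ : Fin K → Ω → ℕ∞) (X : Fin K → ℕ → Ω → E)
    (hM : CompoundDetection.IsIIDModel P μ p q θ τ X) :
    CompoundDetection.proposed P τ X α ∈ CompoundDetection.controlled P τ X α ∧
    ∀ t : ℕ, 1 ≤ t →
      IsGreatest
        ((fun S => ∫ ω, CompoundDetection.RL τ S t ω ∂P) ''
          CompoundDetection.controlled P τ X α)
        (∫ ω, CompoundDetection.RL τ (CompoundDetection.proposed P τ X α) t ω ∂P) ∧
      IsLeast
        ((fun S => ∫ ω, CompoundDetection.CD S t ω ∂P) ''
          CompoundDetection.controlled P τ X α)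
        (∫ ω, CompoundDetection.CD (CompoundDetection.proposed P τ X α) t ω ∂P) := by
  -- Normalization of `p` and `q` is assumed stream by stream, so without streams it is lost; but
  -- then there is only one index set process.
  rcases Nat.eq_zero_or_pos K with rfl | hK
  · have hmem : CompoundDetection.proposed P τ X α ∈ CompoundDetection.controlled P τ X α := by
      refine ⟨CompoundDetection.isProcedure_proposed P τ X α, fun t ht => ?_⟩
      obtain ⟨t, rfl⟩ := Nat.exists_eq_add_of_le' ht
      have h0 : CompoundDetection.FNP τ (CompoundDetection.proposed P τ X α) (t + 1) = 0 := by
        ext ω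
        simp [CompoundDetection.FNP, Finset.eq_empty_of_isEmpty]
      simp only [CompoundDetection.LFNR, h0, condExp_zero]
      exact Filter.Eventually.of_forall fun ω => hα0.le
    refine ⟨hmem, fun t _ => ⟨⟨⟨_, hmem, rfl⟩, ?_⟩, ⟨⟨_, hmem, rfl⟩, ?_⟩⟩⟩
    · rintro _ ⟨S, _, rfl⟩
      rw [Subsingleton.elim S (CompoundDetection.proposed P τ X α)]
    · rintro _ ⟨S, _, rfl⟩
      rw [Subsingleton.elim S (CompoundDetection.proposed P τ X α)]
  · obtain ⟨ν, a, b, Pp, Pq, hν, hPp, hPq, h⟩ := hM.exists_isObserved hθ0 hθ1 hK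
    have hmem := h.proposed_mem_controlled hα0.le
    refine ⟨hmem, fun t ht => ⟨⟨⟨_, hmem, rfl⟩, ?_⟩, ⟨⟨_, hmem, rfl⟩, ?_⟩⟩⟩
    · rintro _ ⟨S, hS, rfl⟩
      exact h.integral_RL_le hα0.le hS t
    · rintro _ ⟨S, hS, rfl⟩
      obtain ⟨t, rfl⟩ := Nat.exists_eq_add_of_le' ht
      exact h.le_integral_CD hα0.le hS t
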